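/- Let $d\ge 1$ be an integer, let $\gamma\ge 1$ be real, let $\alpha>\pi/4$, and put $\mathscr S_\alpha=\{z\in\mathbb C:|\Im z|<\alpha\}$ and $\mathbb C^{\pm}=\{z\in\mathbb C:\pm\Im z>0\}$. Let $H_0=-\Delta$ in $L^2(\mathbb R^d)$ with domain $H^2(\mathbb R^d)$, and let $V:\mathbb R^d\to\mathbb C$ be dilation analytic on $\mathscr S_\alpha$, that is: (a) $V\in L^{\gamma+d/2}(\mathbb R^d;\mathbb C)$; (b) $V$ is $H_0$-compact: the domain of multiplication by $V$ contains $H^2(\mathbb R^d)$, and $V(H_0+1)^{-1}$ is compact on $L^2(\mathbb R^d)$; (c) the map $\theta\mapsto V_\theta:=V(e^{\theta}\,\cdot\,)$, $\theta\in\mathbb R$, has an analytic continuation $\theta\mapsto V_\theta$ to $\mathscr S_\alpha$ with values in $L^{\gamma+d/2}(\mathbb R^d;\mathbb C)$; (d) the map $\theta\mapsto V_\theta(H_0+1)^{-1}$, $\theta\in\mathbb R$, extends to an analytic function on $\mathscr S_\alpha$ with values in the bounded operators on $L^2(\mathbb R^d)$. Let $H=H_0+V$ and, for $\theta\in\mathscr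 S_\alpha$, $H(\theta)=e^{-2\theta}H_0+V_\theta$. The algebraic multiplicity of a complex number $\lambda$ for an operator $T$ is $\sup_{k\in\mathbb N}\dim\ker[(T-\lambda)^k]\in\mathbb N\cup\{\infty\}$. Let $\lambda$ be an eigenvalue of $H$ and let $\theta\in\mathscr S_\alpha$ with $|\Im\theta|\le\pi/2$, where either $\lambda,\theta\in\mathbb C^{+}$ or $\lambda,\theta\in\mathbb C^{-}$. Then $\lambda$ is an eigenvalue of $H(\theta)$, and its algebraic multiplicity for $H(\theta)$ equals its algebraic multiplicity for $H$. -/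

import Mathlib

open MeasureTheory
open scoped ENNReal SchwartzMap Laplacian

noncomputable section

namespace DilationAnalytic

/-- The Euclidean space `ℝ^d`. -/
abbrev Space (d : ℕ) : Type := EuclideanSpace ℝ (Fin d)

/-- The Hilbert space `L²(ℝ^d; ℂ)`. -/
abbrev L2 (d : ℕ) : Type := Lp ℂ 2 (volume : Measure (Space d))

/-- The exponent `γ + d/2`. -/
abbrev potExp (d : ℕ) (γ : ℝ) : ℝ≥0∞ := ENNReal.ofReal (γ + d / 2)

instance fact_one_le_potExp (d : ℕ) (γ : ℝ) [h : Fact (1 ≤ γ)] : Fact (1 ≤ potExp d γ) :=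
  ⟨by
    rw [potExp, ENNReal.one_le_ofReal]
    have h1 : (0 : ℝ) ≤ (d : ℝ) / 2 := by positivity
    linarith [h.out]⟩

/-- The Sobolev space `H²(ℝ^d)`, as a subspace of `L²(ℝ^d)`. -/
def sobolevH2 (d : ℕ) : Submodule ℂ (L2 d) where
  carrier := {u | TemperedDistribution.MemSobolev 2 2 (u : 𝓢'(Space d, ℂ))}
  zero_mem' := by
    have h := TemperedDistribution.memSobolev_fun_zero (Space d) ℂ 2 2
    rw [← map_zero (Lp.toTemperedDistributionCLM ℂ (volume : Measure (Space d)) 2)] at h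
    exact h
  add_mem' := by
    intro u v hu hv
    have h := TemperedDistribution.MemSobolev.add hu hv
    rw [← Lp.toTemperedDistributionCLM_apply, ← Lp.toTemperedDistributionCLM_apply,
      ← map_add] at h
    exact h
  smul_mem' := by
    intro c u hu
    have h := TemperedDistribution.MemSobolev.smul c hu
    rw [← Lp.toTemperedDistributionCLM_apply, ← map_smul] at h
    exact h

theorem exists_laplacian_eq {d : ℕ} (u : sobolevH2 d) :
    ∃ f : L2 d, (f : 𝓢'(Space d, ℂ)) = -Δ ((u : L2 d) : 𝓢'(Space d, ℂ)) := by
  have h := TemperedDistribution.MemSobolev.laplacian u.2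
  rw [sub_self, TemperedDistribution.memSobolev_zero_iff] at h
  obtain ⟨g, hg⟩ := h
  refine ⟨-g, ?_⟩
  rw [hg, ← Lp.toTemperedDistributionCLM_apply, map_neg]
  rfl

theorem toTemperedDistribution_inj {d : ℕ} {f g : L2 d}
    (h : (f : 𝓢'(Space d, ℂ)) = (g : 𝓢'(Space d, ℂ))) : f = g := by
  have hk := Lp.ker_toTemperedDistributionCLM_eq_bot (F := ℂ)
    (μ := (volume : Measure (Space d))) (p := 2)
  exact LinearMap.ker_eq_bot.1 hk h

theorem laplacian_coe_add {d : ℕ} {u v f g h : L2 d}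
    (hf : (f : 𝓢'(Space d, ℂ)) = -Δ (u : 𝓢'(Space d, ℂ)))
    (hg : (g : 𝓢'(Space d, ℂ)) = -Δ (v : 𝓢'(Space d, ℂ)))
    (hh : (h : 𝓢'(Space d, ℂ)) = -Δ ((u + v : L2 d) : 𝓢'(Space d, ℂ))) : h = f + g := by
  apply toTemperedDistribution_inj
  rw [hh]
  simp only [← Lp.toTemperedDistributionCLM_apply] at hf hg ⊢
  rw [map_add, map_add, hf, hg, ← TemperedDistribution.laplacianCLM_apply, map_add]
  simp only [TemperedDistribution.laplacianCLM_apply]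
  abel

theorem laplacian_coe_smul {d : ℕ} (c : ℂ) {u f h : L2 d}
    (hf : (f : 𝓢'(Space d, ℂ)) = -Δ (u : 𝓢'(Space d, ℂ)))
    (hh : (h : 𝓢'(Space d, ℂ)) = -Δ ((c • u : L2 d) : 𝓢'(Space d, ℂ))) : h = c • f := by
  apply toTemperedDistribution_inj
  rw [hh]
  simp only [← Lp.toTemperedDistributionCLM_apply] at hf ⊢
  rw [map_smul, map_smul, hf, ← TemperedDistribution.laplacianCLM_apply, map_smul]
  simp only [TemperedDistribution.laplacianCLM_apply, smul_neg]

/-- The free Hamiltonian `H₀ = -Δ` in `L²(ℝ^d)` with domain `H²(ℝ^d)`: for `u ∈ H²(ℝ^d)`, `H₀ u` is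
the (unique) `L²` function that represents the distribution `-Δ u`. -/
def freeHamiltonian (d : ℕ) : L2 d →ₗ.[ℂ] L2 d where
  domain := sobolevH2 d
  toFun :=
    { toFun := fun u => (exists_laplacian_eq u).choose
      map_add' := fun u v => laplacian_coe_add (exists_laplacian_eq u).choose_spec
        (exists_laplacian_eq v).choose_spec (exists_laplacian_eq (u + v)).choose_spec
      map_smul' := fun c u => laplacian_coe_smul c (exists_laplacian_eq u).choose_spec
        (exists_laplacian_eq (c • u)).choose_spec }

/-- `H₀ u = -Δ u` in the sense of distributions. -/
theorem freeHamiltonian_apply {d : ℕ} (u : (freeHamiltonian d).domain) :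
    ((freeHamiltonian d u : L2 d) : 𝓢'(Space d, ℂ)) = -Δ ((u : L2 d) : 𝓢'(Space d, ℂ)) :=
  (exists_laplacian_eq u).choose_spec

theorem mul_coe_add {d : ℕ} (W : Space d → ℂ) (u v : L2 d) :
    (fun x => W x * (u + v : L2 d) x) =ᵐ[volume] (fun x => W x * u x) + fun x => W x * v x := by
  filter_upwards [Lp.coeFn_add u v] with x hx
  rw [hx, Pi.add_apply, Pi.add_apply, mul_add]

theorem mul_coe_smul {d : ℕ} (W : Space d → ℂ) (c : ℂ) (u : L2 d) :
    (fun x => W x * (c • u : L2 d) x) =ᵐ[volume] c • fun x => W x * u x := by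
  filter_upwards [Lp.coeFn_smul c u] with x hx
  rw [hx, Pi.smul_apply, Pi.smul_apply, smul_eq_mul, smul_eq_mul, mul_left_comm]

theorem mul_coe_zero {d : ℕ} (W : Space d → ℂ) :
    (fun x => W x * (0 : L2 d) x) =ᵐ[volume] 0 := by
  filter_upwards [Lp.coeFn_zero ℂ 2 (volume : Measure (Space d))] with x hx
  rw [hx, Pi.zero_apply, mul_zero]

/-- The subspace `{u ∈ L² : W u ∈ L²}`. -/
def mulDomain {d : ℕ} (W : Space d → ℂ) : Submodule ℂ (L2 d) where
  carrier := {u | MemLp (fun x => W x * u x) 2 volume}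
  zero_mem' := (memLp_congr_ae (mul_coe_zero W)).2 MemLp.zero
  add_mem' := fun {u v} hu hv => (memLp_congr_ae (mul_coe_add W u v)).2 (MemLp.add hu hv)
  smul_mem' := fun c u hu => (memLp_congr_ae (mul_coe_smul W c u)).2 (MemLp.const_smul hu c)

/-- The operator of multiplication by the function `W` in `L²(ℝ^d)`, with its maximal domain
`{u ∈ L² : W u ∈ L²}`. -/
def mulOp {d : ℕ} (W : Space d → ℂ) : L2 d →ₗ.[ℂ] L2 d where
  domain := mulDomain W
  toFun :=
    { toFun := fun u => MemLp.toLp (fun x => W x * (u : L2 d) x) u.2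
      map_add' := fun u v =>
        (MemLp.toLp_congr (u + v).2 (MemLp.add u.2 v.2) (mul_coe_add W u v)).trans
          (MemLp.toLp_add u.2 v.2)
      map_smul' := fun c u =>
        (MemLp.toLp_congr (c • u).2 (MemLp.const_smul u.2 c) (mul_coe_smul W c u)).trans
          (MemLp.toLp_const_smul c u.2) }

/-- The Schrödinger operator `H = H₀ + V`. -/
def hamiltonian {d : ℕ} (V : Space d → ℂ) : L2 d →ₗ.[ℂ] L2 d :=
  freeHamiltonian d + mulOp V

/-- The operator `e^{-2θ} H₀ + W`; with `W = V_θ` this is the dilated operator `H(θ)`. -/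
def dilatedHamiltonian {d : ℕ} (θ : ℂ) (W : Space d → ℂ) : L2 d →ₗ.[ℂ] L2 d :=
  Complex.exp (-2 * θ) • freeHamiltonian d + mulOp W

/-- `K` is the operator `W (H₀ + 1)⁻¹`: the domain of `W` contains the domain of `H₀`, and
`K ((H₀ + 1) u) = W u` for all `u` in the domain of `H₀` (recall that `H₀ + 1` maps its domain onto
`L²(ℝ^d)`). -/
def IsMulResolvent {d : ℕ} (W : Space d → ℂ) (K : L2 d →L[ℂ] L2 d) : Prop :=
  ∀ u : (freeHamiltonian d).domain, ∃ hu : (u : L2 d) ∈ (mulOp W).domain,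
    K (freeHamiltonian d u + (u : L2 d)) = mulOp W ⟨(u : L2 d), hu⟩

/-- The strip `{z : |Im z| < α}`. -/
def strip (α : ℝ) : Set ℂ := {z | |z.im| < α}

/-- `V` is dilation analytic on the strip `{|Im z| < α}`, and `θ ↦ 𝒱 θ` is the analytic continuation
of `θ ↦ V_θ = V(e^θ ·)` to that strip (it is determined on the strip by `V`). -/
structure IsDilationAnalytic {d : ℕ} {γ : ℝ} [Fact (1 ≤ γ)] (α : ℝ) (V : Space d → ℂ)
    (𝒱 : ℂ → Lp ℂ (potExp d γ) (volume : Measure (Space d))) : Prop where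
  /-- `V` is in `L^{γ + d/2}`. -/
  memLp : MemLp V (potExp d γ) volume
  /-- `V` is `H₀`-compact. -/
  relCompact : ∃ K : L2 d →L[ℂ] L2 d, IsCompactOperator K ∧ IsMulResolvent V K
  /-- `𝒱` is an `L^{γ + d/2}`-valued analytic function on the strip. -/
  analytic : DifferentiableOn ℂ 𝒱 (strip α)
  /-- `𝒱 θ = V(e^θ ·)` for real `θ`. -/
  eq_dilation : ∀ t : ℝ, (𝒱 (t : ℂ) : Space d → ℂ) =ᵐ[volume] fun x => V (Real.exp t • x)
  /-- `V_θ (H₀ + 1)⁻¹`, `θ` real, extends to an analytic function on the strip with values in the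
  bounded operators. -/
  resolvent_analytic : ∃ F : ℂ → L2 d →L[ℂ] L2 d, DifferentiableOn ℂ F (strip α) ∧
    ∀ t : ℝ, IsMulResolvent (fun x => V (Real.exp t • x)) (F (t : ℂ))

/-- `λ` is an eigenvalue of the (unbounded) operator `T`. -/
def IsEigenvalue {d : ℕ} (T : L2 d →ₗ.[ℂ] L2 d) (l : ℂ) : Prop :=
  ∃ u : T.domain, (u : L2 d) ≠ 0 ∧ T u = l • (u : L2 d)

/-- `ker (T - λ)^k`, where the powers of the unbounded operator `T - λ` have their natural domains:
`u ∈ ker (T - λ)^(k+1)` iff `u` is in the domain of `T` and `(T - λ) u ∈ ker (T - λ)^k`. -/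
def kerPow {d : ℕ} (T : L2 d →ₗ.[ℂ] L2 d) (l : ℂ) : ℕ → Submodule ℂ (L2 d)
  | 0 => ⊥
  | k + 1 => ((kerPow T l k).comap (T.toFun - l • T.domain.subtype)).map T.domain.subtype

theorem mem_kerPow_succ {d : ℕ} (T : L2 d →ₗ.[ℂ] L2 d) (l : ℂ) (k : ℕ) (v : L2 d) :
    v ∈ kerPow T l (k + 1) ↔
      ∃ u : T.domain, (u : L2 d) = v ∧ T u - l • (u : L2 d) ∈ kerPow T l k := by
  simp only [kerPow, Submodule.mem_map, Submodule.mem_comap]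
  exact ⟨fun ⟨u, h1, h2⟩ => ⟨u, h2, h1⟩, fun ⟨u, h1, h2⟩ => ⟨u, h2, h1⟩⟩

/-- The algebraic multiplicity `sup_k dim ker (T - λ)^k`. -/
def algMult {d : ℕ} (T : L2 d →ₗ.[ℂ] L2 d) (l : ℂ) : ℕ∞ :=
  ⨆ k : ℕ, Cardinal.toENat (Module.rank ℂ (kerPow T l k))

end DilationAnalytic

end

noncomputable section

namespace DilationAnalytic

open Filter Topology

universe u

/-! Fix `k` and put R = (H₀ + 1)⁻¹, A(z) = (e^{-2z} H₀ - l + V_z) R. Since R maps L² bijectively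
onto H², ker (H(z) - l)^k is isomorphic to the space of chains A z_j = R z_{j+1} with z_k = 0. This
is the kernel of a bounded block operator on k copies of L² that is analytic in z, so unbounded
operators and their domains disappear. The claim becomes: the dimension of this kernel is the same
at z = 0 and at z = θ (`rank_kerPow_eq`).

Two facts give this. Along a horizontal line the dimension is constant, because real dilations
intertwine the pencils (`rank_chains_add_real`). Where l ∉ e^{-2z}[0, ∞), A(z) is an invertible
operator plus a compact one, so near such a point z₀ the kernel is, up to isomorphism, that of an
analytic family of matrices. A second reduction makes the matrix vanish at z₀; constant nullity on
the horizontal line makes it vanish on that line, and the identity theorem makes it vanish near z₀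
(`eventually_rank_ker_eq`).

So the dimension is locally constant along the segment from 0 to θ. On that segment the half-line
e^{-2z}[0, ∞) stays out of the open half-plane of l. -/

/-- An analytic function on a domain that vanishes on the horizontal line through one of the points
of the domain vanishes identically. -/
theorem eq_zero_of_forall_add_real_eq_zero {E : Type*} [NormedAddCommGroup E] [NormedSpace ℂ E]
    [CompleteSpace E] {U : Set ℂ} (hU : IsOpen U) (hUc : IsPreconnected U) {f : ℂ → E}
    (hf : DifferentiableOn ℂ f U) {z₀ : ℂ} (hz₀ : z₀ ∈ U)
    (h : ∀ s : ℝ, z₀ + s ∈ U → f (z₀ + s) = 0) : ∀ z ∈ U, f z = 0 := by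
  have hfa : AnalyticOnNhd ℂ f U := hf.analyticOnNhd hU
  refine fun z hz => hfa.eqOn_zero_of_preconnected_of_frequently_eq_zero hUc hz₀ ?_ hz
  have hc : Tendsto (fun s : ℝ => z₀ + (s : ℂ)) (𝓝[≠] 0) (𝓝[≠] z₀) := by
    refine tendsto_nhdsWithin_iff.2 ⟨?_, ?_⟩
    · refine Tendsto.mono_left ?_ nhdsWithin_le_nhds
      have : Continuous (fun s : ℝ => z₀ + (s : ℂ)) := by fun_prop
      simpa using this.tendsto 0
    · filter_upwards [self_mem_nhdsWithin] with s hs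
      simpa using hs
  have hev : ∀ᶠ s : ℝ in 𝓝[≠] 0, f (z₀ + s) = 0 := by
    filter_upwards [hc.eventually (mem_nhdsWithin_of_mem_nhds (hU.mem_nhds hz₀))] with s hs
    exact h s hs
  exact hc.frequently hev.frequently

/-! ### Grushin reduction of analytic families to finite dimension -/

section Grushin

variable {X N : Type u} [NormedAddCommGroup X] [NormedSpace ℂ X]
  [NormedAddCommGroup N] [NormedSpace ℂ N]

/-- If `A + J P` is invertible, then `ker A` is isomorphic to `ker (1 - P (A + J P)⁻¹ J)`. -/
theorem rank_ker_eq_of_isUnit {A : X →L[ℂ] X} {P : X →L[ℂ] N} {J : N →L[ℂ] X}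
    (h : IsUnit (A + J ∘L P)) :
    Module.rank ℂ A.ker = Module.rank ℂ (1 - P ∘L Ring.inverse (A + J ∘L P) ∘L J : N →L[ℂ] N).ker := by
  set B := A + J ∘L P with hB
  have h1 : ∀ x, Ring.inverse B (B x) = x := fun x => by
    have := congrArg (fun T : X →L[ℂ] X => T x) (Ring.inverse_mul_cancel B h)
    simpa using this
  have h2 : ∀ x, B (Ring.inverse B x) = x := fun x => by
    have := congrArg (fun T : X →L[ℂ] X => T x) (Ring.mul_inverse_cancel B h)
    simpa using this
  -- On ker A the operators B and J P agree, so `P` and B⁻¹ J are mutually inverse between the two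
  -- kernels.
  have hk : ∀ x, A x = 0 → Ring.inverse B (J (P x)) = x := fun x hx => by
    have : B x = J (P x) := by simp [hB, hx]
    rw [← this, h1]
  refine LinearEquiv.rank_eq (LinearEquiv.ofLinearMap
    (P.toLinearMap.restrict (p := A.ker)
      (q := (1 - P ∘L Ring.inverse B ∘L J : N →L[ℂ] N).ker) ?_)
    ((Ring.inverse B ∘L J).toLinearMap.restrict (q := A.ker)
      (p := (1 - P ∘L Ring.inverse B ∘L J : N →L[ℂ] N).ker) ?_) ?_ ?_)
  · intro x hx
    have hx' : A x = 0 := hx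
    simp [hk x hx']
  · intro c hc
    have hc' : P (Ring.inverse B (J c)) = c := by
      have : c - P (Ring.inverse B (J c)) = 0 := hc
      exact (sub_eq_zero.1 this).symm
    have h3 := h2 (J c)
    rw [hB, add_apply, ContinuousLinearMap.comp_apply, ← hB, hc'] at h3
    change A (Ring.inverse B (J c)) = 0
    simpa using h3
  · ext ⟨c, hc⟩
    have : c - P (Ring.inverse B (J c)) = 0 := hc
    exact (sub_eq_zero.1 this).symm
  · ext ⟨x, hx⟩
    exact hk x hx

/-- Local reduction of the kernels of an analytic family of operators to a finite-dimensional
analytic family. -/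
theorem exists_reduction [CompleteSpace X] {A : ℂ → X →L[ℂ] X} {U : Set ℂ} (hU : IsOpen U)
    (hA : DifferentiableOn ℂ A U) {z₀ : ℂ} (hz₀ : z₀ ∈ U) {P : X →L[ℂ] N} {J : N →L[ℂ] X}
    (h : IsUnit (A z₀ + J ∘L P)) :
    ∃ r > 0, Metric.ball z₀ r ⊆ U ∧ ∃ M : ℂ → N →L[ℂ] N,
      DifferentiableOn ℂ M (Metric.ball z₀ r) ∧
      ∀ z ∈ Metric.ball z₀ r, Module.rank ℂ (A z).ker = Module.rank ℂ (M z).ker := by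
  have hcont : ContinuousAt (fun z => A z + J ∘L P) z₀ :=
    ((hA.differentiableAt (hU.mem_nhds hz₀)).continuousAt).add continuousAt_const
  have hev : ∀ᶠ z in 𝓝 z₀, IsUnit (A z + J ∘L P) :=
    hcont.eventually (Units.isOpen.mem_nhds h)
  obtain ⟨r, hr, hball⟩ := Metric.eventually_nhds_iff_ball.1 (hev.and (hU.mem_nhds hz₀))
  refine ⟨r, hr, fun z hz => (hball z hz).2,
    fun z => 1 - P ∘L Ring.inverse (A z + J ∘L P) ∘L J, ?_,
    fun z hz => rank_ker_eq_of_isUnit (hball z hz).1⟩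
  intro z hz
  have hd : DifferentiableAt ℂ (fun z => A z + J ∘L P) z :=
    (hA.differentiableAt (hU.mem_nhds (hball z hz).2)).add_const _
  have hi : DifferentiableAt ℂ (fun z => Ring.inverse (A z + J ∘L P)) z :=
    DifferentiableAt.fun_comp' z (differentiableAt_inverse (𝕜 := ℂ) (hball z hz).1) hd
  exact (((differentiableAt_const P).clm_comp
    (hi.clm_comp (differentiableAt_const J))).const_sub 1).differentiableWithinAt

/-- An endomorphism of a finite-dimensional space becomes invertible after adding a map that
factors through its kernel. -/
theorem exists_isUnit_add_comp_ker [FiniteDimensional ℂ N] (f : N →L[ℂ] N) :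
    ∃ (P : N →L[ℂ] f.ker) (J : f.ker →L[ℂ] N), IsUnit (f + J ∘L P) := by
  obtain ⟨C, hC⟩ := Submodule.exists_isCompl (f.range)
  obtain ⟨K, hK⟩ := Submodule.exists_isCompl (f.ker)
  -- Index zero in finite dimension: the kernel can be mapped isomorphically onto a complement of
  -- the range.
  have hdim : Module.finrank ℂ f.ker = Module.finrank ℂ C := by
    have h1 := Submodule.finrank_add_eq_of_isCompl hC
    have h2 := f.toLinearMap.finrank_range_add_finrank_ker
    omega
  let e : f.ker ≃ₗ[ℂ] C := LinearEquiv.ofFinrankEq _ _ hdim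
  let P : N →ₗ[ℂ] f.ker := Submodule.projectionOnto f.ker K hK
  let J : f.ker →ₗ[ℂ] N := C.subtype ∘ₗ e.toLinearMap
  refine ⟨LinearMap.toContinuousLinearMap P, LinearMap.toContinuousLinearMap J, ?_⟩
  set T := f + LinearMap.toContinuousLinearMap J ∘L LinearMap.toContinuousLinearMap P with hT
  have hTx : ∀ x, T x = f x + (e (P x) : N) := fun x => rfl
  have hinj : Function.Injective T.toLinearMap := by
    refine (injective_iff_map_eq_zero T.toLinearMap).2 fun x hx => ?_
    have hx' : f x + (e (P x) : N) = 0 := hx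
    have hmem : f x ∈ f.range ⊓ C := by
      refine ⟨⟨x, rfl⟩, ?_⟩
      rw [eq_neg_of_add_eq_zero_left hx']
      exact C.neg_mem (e (P x)).2
    rw [hC.inf_eq_bot, Submodule.mem_bot] at hmem
    rw [hmem, zero_add] at hx'
    have hPx : P x = 0 := by
      rw [Submodule.coe_eq_zero] at hx'
      exact e.map_eq_zero_iff.1 hx'
    have hxk : x ∈ f.ker := hmem
    have : P x = ⟨x, hxk⟩ := Submodule.projectionOnto_apply_left hK ⟨x, hxk⟩
    rw [hPx] at this
    exact (congrArg Subtype.val this).symm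
  have hbij := LinearMap.injective_iff_surjective.1 hinj
  exact ContinuousLinearMap.isUnit_iff_bijective.2 ⟨hinj, hbij⟩

/-- If `A` is an analytic family of operators such that `A z₀` is invertible up to an operator of
finite rank, and `dim ker A` is constant on the horizontal line through `z₀`, then it is constant
near `z₀`. -/
theorem eventually_rank_ker_eq [CompleteSpace X] [FiniteDimensional ℂ N]
    {A : ℂ → X →L[ℂ] X} {U : Set ℂ} (hU : IsOpen U)
    (hA : DifferentiableOn ℂ A U) {z₀ : ℂ} (hz₀ : z₀ ∈ U) {P : X →L[ℂ] N} {J : N →L[ℂ] X}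
    (h : IsUnit (A z₀ + J ∘L P))
    (hc : ∀ s : ℝ, z₀ + s ∈ U → Module.rank ℂ (A (z₀ + s)).ker = Module.rank ℂ (A z₀).ker) :
    ∀ᶠ z in 𝓝 z₀, Module.rank ℂ (A z).ker = Module.rank ℂ (A z₀).ker := by
  obtain ⟨r, hr, hrU, M, hM, hAM⟩ := exists_reduction hU hA hz₀ h
  -- The second reduction lands in `ker (M z₀)` itself, so that having a kernel of the same
  -- dimension as at z₀ means being the zero operator.
  obtain ⟨P', J', h'⟩ := exists_isUnit_add_comp_ker (M z₀)
  have : CompleteSpace N := FiniteDimensional.complete ℂ N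
  obtain ⟨r', hr', hrU', M', hM', hMM'⟩ :=
    exists_reduction Metric.isOpen_ball hM (Metric.mem_ball_self hr) h'
  have : CompleteSpace (M z₀).ker := FiniteDimensional.complete ℂ _
  have hz : ∀ z ∈ Metric.ball z₀ r', M' z = 0 := by
    refine eq_zero_of_forall_add_real_eq_zero Metric.isOpen_ball
      (convex_ball z₀ r').isPreconnected hM' (Metric.mem_ball_self hr') fun s hs => ?_
    have hs1 := hrU' hs
    have h1 : Module.rank ℂ (M' (z₀ + s)).ker = Module.rank ℂ (M z₀).ker := by
      rw [← hMM' _ hs, ← hAM _ hs1, hc s (hrU hs1), hAM _ (Metric.mem_ball_self hr)]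
    have h2 : (M' (z₀ + s)).ker = ⊤ :=
      Submodule.eq_top_of_finrank_eq (by simp only [Module.finrank, h1])
    ext1 x
    have : x ∈ (M' (z₀ + s)).ker := h2 ▸ Submodule.mem_top
    exact this
  filter_upwards [Metric.ball_mem_nhds z₀ hr'] with z hzb
  have h0 := Metric.mem_ball_self (x := z₀) hr'
  rw [hAM _ (hrU' hzb), hMM' _ hzb, hz _ hzb, hAM _ (hrU' h0), hMM' _ h0, hz _ h0]

end Grushin

/-- On a Hilbert space, a compact perturbation of an invertible operator is invertible up to an
operator of finite rank. -/
theorem exists_finite_rank_correction {X : Type u} [NormedAddCommGroup X] [InnerProductSpace ℂ X]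
    [CompleteSpace X] {B K : X →L[ℂ] X} (hB : IsUnit B) (hK : IsCompactOperator K) :
    ∃ S : Submodule ℂ X, FiniteDimensional ℂ S ∧ ∃ (P : X →L[ℂ] S) (J : S →L[ℂ] X),
      IsUnit (B + K + J ∘L P) := by
  obtain ⟨ε, hε, hball⟩ := Metric.isOpen_iff.1 (Units.isOpen (R := X →L[ℂ] X)) B hB
  have htb : TotallyBounded (K '' Metric.closedBall 0 1) :=
    (hK.isCompact_closure_image_closedBall 1).totallyBounded.subset subset_closure
  obtain ⟨t, ht, htc⟩ := Metric.totallyBounded_iff.1 htb (ε / 2) (half_pos hε)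
  let S := Submodule.span ℂ t
  have hS : FiniteDimensional ℂ S := FiniteDimensional.span_of_finite ℂ ht
  -- The correction is minus the projection of K to S. What remains besides B is the component of K
  -- orthogonal to S, of norm at most ε/2 because S contains an ε/2-net of the image of the unit
  -- ball.
  refine ⟨S, hS, S.orthogonalProjectionOnto ∘L K, -S.subtypeL, hball ?_⟩
  rw [Metric.mem_ball, dist_eq_norm]
  refine lt_of_le_of_lt ?_ (half_lt_self hε)
  refine ContinuousLinearMap.opNorm_le_of_unit_norm (half_pos hε).le fun x hx => ?_
  have hKx : K x ∈ K '' Metric.closedBall 0 1 := ⟨x, by simp [hx], rfl⟩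
  obtain ⟨y, hy, hyx⟩ := Set.mem_iUnion₂.1 (htc hKx)
  have h1 : (B + K + (-S.subtypeL) ∘L S.orthogonalProjectionOnto ∘L K - B) x
      = K x - S.orthogonalProjectionOnto (K x) := by
    simp
    abel
  rw [h1]
  refine le_trans ?_ (Metric.mem_ball.1 hyx).le
  rw [dist_eq_norm]
  have hmin := S.starProjection_minimal (K x)
  have := ciInf_le (f := fun w : S => ‖K x - w‖) ⟨0, by rintro _ ⟨w, rfl⟩; positivity⟩
    ⟨y, Submodule.subset_span hy⟩
  exact hmin.trans_le this

/-! ### Chains of an operator pencil -/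

section Chains

variable {X : Type u} [NormedAddCommGroup X] [NormedSpace ℂ X]

/-- The sequences `z₀, …, z_{k-1}, 0, 0, …` with `A z_j = R z_{j+1}` for all `j`. -/
def chains (A R : X →L[ℂ] X) (k : ℕ) : Submodule ℂ (ℕ → X) where
  carrier := {z | (∀ j, k ≤ j → z j = 0) ∧ ∀ j, A (z j) = R (z (j + 1))}
  zero_mem' := ⟨fun _ _ => rfl, fun _ => by simp⟩
  add_mem' := fun {z w} hz hw =>
    ⟨fun j hj => by simp [hz.1 j hj, hw.1 j hj], fun j => by simp [hz.2 j, hw.2 j]⟩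
  smul_mem' := fun c z hz =>
    ⟨fun j hj => by simp [hz.1 j hj], fun j => by simp [hz.2 j]⟩

/-- The shift `(z₀, …, z_{k-1}) ↦ (R z₁, …, R z_{k-1}, 0)`. -/
def shift (R : X →L[ℂ] X) (k : ℕ) : (Fin k → X) →L[ℂ] (Fin k → X) :=
  ContinuousLinearMap.pi fun i =>
    if h : (i : ℕ) + 1 < k then R ∘L ContinuousLinearMap.proj ⟨(i : ℕ) + 1, h⟩ else 0

theorem shift_apply_of_lt (R : X →L[ℂ] X) {k : ℕ} (z : Fin k → X) (i : Fin k)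
    (h : (i : ℕ) + 1 < k) : shift R k z i = R (z ⟨i + 1, h⟩) := by
  simp [shift, h]

theorem shift_apply_of_not_lt (R : X →L[ℂ] X) {k : ℕ} (z : Fin k → X) (i : Fin k)
    (h : ¬ (i : ℕ) + 1 < k) : shift R k z i = 0 := by
  simp [shift, h]

theorem shift_pow_apply (R : X →L[ℂ] X) {k : ℕ} (m : ℕ) (z : Fin k → X) (i : Fin k)
    (h : k ≤ i + m) : (shift R k ^ m) z i = 0 := by
  induction m generalizing i with
  | zero => omega
  | succ m ih =>
    rw [pow_succ', mul_apply_eq_comp]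
    by_cases hi : (i : ℕ) + 1 < k
    · rw [shift_apply_of_lt _ _ _ hi, ih ⟨i + 1, hi⟩ (by simp only; omega), map_zero]
    · rw [shift_apply_of_not_lt _ _ _ hi]

theorem isNilpotent_shift (R : X →L[ℂ] X) (k : ℕ) : IsNilpotent (shift R k) :=
  ⟨k, by ext1 z; ext1 i; exact shift_pow_apply R k z i (by omega)⟩

/-- The diagonal operator with entries `T`. -/
def diag {Y : Type u} [NormedAddCommGroup Y] [NormedSpace ℂ Y] (T : X →L[ℂ] Y) (k : ℕ) :
    (Fin k → X) →L[ℂ] (Fin k → Y) :=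
  ContinuousLinearMap.pi fun i => T ∘L ContinuousLinearMap.proj i

@[simp]
theorem diag_apply {Y : Type u} [NormedAddCommGroup Y] [NormedSpace ℂ Y] (T : X →L[ℂ] Y) {k : ℕ}
    (z : Fin k → X) (i : Fin k) : diag T k z i = T (z i) := rfl

theorem diag_mul_shift (T R : X →L[ℂ] X) (k : ℕ) : diag T k * shift R k = shift (T * R) k := by
  ext1 z
  ext1 i
  rw [mul_apply_eq_comp, diag_apply]
  by_cases hi : (i : ℕ) + 1 < k
  · rw [shift_apply_of_lt _ _ _ hi, shift_apply_of_lt _ _ _ hi, mul_apply_eq_comp]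
  · rw [shift_apply_of_not_lt _ _ _ hi, shift_apply_of_not_lt _ _ _ hi, map_zero]

theorem isUnit_diag {T : X →L[ℂ] X} (hT : IsUnit T) (k : ℕ) : IsUnit (diag T k) := by
  obtain ⟨u, rfl⟩ := hT
  refine ⟨⟨diag u k, diag ↑u⁻¹ k, ?_, ?_⟩, rfl⟩
  · ext1 z
    ext1 i
    exact congrArg (fun S : X →L[ℂ] X => S (z i)) u.mul_inv
  · ext1 z
    ext1 i
    exact congrArg (fun S : X →L[ℂ] X => S (z i)) u.inv_mul

/-- Factoring out the diagonal leaves 1 minus a nilpotent shift, so the block operator is invertible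
whatever R is. -/
theorem isUnit_diag_sub_shift {T : X →L[ℂ] X} (hT : IsUnit T) (R : X →L[ℂ] X) (k : ℕ) :
    IsUnit (diag T k - shift R k) := by
  have h : diag T k - shift R k = diag T k * (1 - shift (Ring.inverse T * R) k) := by
    rw [mul_sub, mul_one, diag_mul_shift, ← mul_assoc, Ring.mul_inverse_cancel T hT, one_mul]
  rw [h]
  exact (isUnit_diag hT k).mul (isNilpotent_shift _ k).isUnit_one_sub

theorem differentiableOn_diag {A : ℂ → X →L[ℂ] X} {U : Set ℂ} (hA : DifferentiableOn ℂ A U)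
    (k : ℕ) : DifferentiableOn ℂ (fun z => diag (A z) k) U := by
  -- Written as a finite sum of compositions, `diag T k` is visibly analytic in T.
  have h : ∀ T : X →L[ℂ] X, diag T k = ∑ i : Fin k,
      ContinuousLinearMap.single ℂ (fun _ : Fin k => X) i ∘L T ∘L
        ContinuousLinearMap.proj i := by
    intro T
    ext1 z
    ext1 i
    rw [diag_apply, sum_apply, Finset.sum_apply, Finset.sum_eq_single i]
    · simp
    · intro j _ hj
      simp [Pi.single_eq_of_ne hj.symm]
    · simp
  simp_rw [h]
  refine DifferentiableOn.fun_sum fun i _ => ?_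
  exact (differentiableOn_const _).clm_comp (hA.clm_comp (differentiableOn_const _))

/-- Chains are the kernel of a block operator. -/
theorem rank_chains_eq (A R : X →L[ℂ] X) (k : ℕ) :
    Module.rank ℂ (chains A R k) = Module.rank ℂ (diag A k - shift R k).ker := by
  let ext : (Fin k → X) →ₗ[ℂ] (ℕ → X) :=
    { toFun := fun z n => if h : n < k then z ⟨n, h⟩ else 0
      map_add' := fun z w => by ext n; by_cases h : n < k <;> simp [h]
      map_smul' := fun c z => by ext n; by_cases h : n < k <;> simp [h] }
  let res : (ℕ → X) →ₗ[ℂ] (Fin k → X) := LinearMap.funLeft ℂ X (fun i : Fin k => (i : ℕ))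
  have hext : ∀ z (n : ℕ) (h : n < k), ext z n = z ⟨n, h⟩ := fun z n h => dif_pos h
  have hext' : ∀ z (n : ℕ), k ≤ n → ext z n = 0 := fun z n h => dif_neg (by omega)
  refine LinearEquiv.rank_eq (LinearEquiv.ofLinearMap
    (res.restrict (p := chains A R k) (q := (diag A k - shift R k).ker) ?_)
    (ext.restrict (q := chains A R k) (p := (diag A k - shift R k).ker) ?_) ?_ ?_)
  · intro z hz
    change diag A k (res z) - shift R k (res z) = 0
    rw [sub_eq_zero]
    ext1 i
    rw [diag_apply]
    by_cases hi : (i : ℕ) + 1 < k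
    · rw [shift_apply_of_lt _ _ _ hi]
      exact hz.2 i
    -- In the last row the shift gives 0, which matches R z_k with z_k = 0.
    · rw [shift_apply_of_not_lt _ _ _ hi]
      refine (hz.2 i).trans ?_
      rw [hz.1 _ (by omega), map_zero]
  · intro z hz
    have hz' : diag A k z - shift R k z = 0 := hz
    rw [sub_eq_zero] at hz'
    refine ⟨hext' z, fun j => ?_⟩
    by_cases hj : j < k
    · have h1 := congrFun hz' ⟨j, hj⟩
      rw [diag_apply] at h1
      rw [hext z j hj, h1]
      by_cases hj' : j + 1 < k
      · rw [shift_apply_of_lt _ _ _ hj', hext z _ hj']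
      · rw [shift_apply_of_not_lt _ _ _ hj', hext' z _ (by omega), map_zero]
    · rw [hext' z _ (by omega), hext' z _ (by omega), map_zero, map_zero]
  · ext1 ⟨z, hz⟩
    refine Subtype.ext (funext fun i => ?_)
    exact hext z i i.2
  · ext1 ⟨z, hz⟩
    refine Subtype.ext (funext fun n => ?_)
    by_cases hn : n < k
    · exact hext (res z) n hn
    · exact (hext' (res z) n (by omega)).trans (hz.1 n (by omega)).symm

/-- A bounded operator that intertwines two pencils maps chains to chains. -/
theorem rank_chains_le {A A' R : X →L[ℂ] X} (T : X →L[ℂ] X) (W : X →L[ℂ] X)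
    (hT : Function.Injective T) (hA : A * T = W * A') (hR : R * T = W * R) (k : ℕ) :
    Module.rank ℂ (chains A' R k) ≤ Module.rank ℂ (chains A R k) := by
  let Φ : (ℕ → X) →ₗ[ℂ] (ℕ → X) := LinearMap.piMap fun _ => T.toLinearMap
  have hΦ : ∀ z j, Φ z j = T (z j) := fun z j => rfl
  have hA' : ∀ x, A (T x) = W (A' x) := fun x => congrArg (fun S : X →L[ℂ] X => S x) hA
  have hR' : ∀ x, R (T x) = W (R x) := fun x => congrArg (fun S : X →L[ℂ] X => S x) hR
  refine LinearMap.rank_le_of_injective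
    (Φ.restrict (p := chains A' R k) (q := chains A R k) ?_) ?_
  · intro z hz
    refine ⟨fun j hj => ?_, fun j => ?_⟩
    · rw [hΦ, hz.1 j hj, map_zero]
    · rw [hΦ, hΦ, hA', hz.2 j, ← hR']
  · intro z w hzw
    refine Subtype.ext (funext fun j => hT ?_)
    exact congrFun (congrArg Subtype.val hzw) j

end Chains

/-- The number of chains of length `k` of an analytic family `A`, with `A z₀` a compact perturbation
of an invertible operator, is constant near `z₀` if it is constant on the horizontal line
through `z₀`. -/
theorem eventually_rank_chains_eq {X : Type u} [NormedAddCommGroup X] [InnerProductSpace ℂ X]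
    [CompleteSpace X] {A : ℂ → X →L[ℂ] X} (R : X →L[ℂ] X) {U : Set ℂ} (hU : IsOpen U)
    (hA : DifferentiableOn ℂ A U) {z₀ : ℂ} (hz₀ : z₀ ∈ U) {B K : X →L[ℂ] X} (hB : IsUnit B)
    (hK : IsCompactOperator K) (hBK : A z₀ = B + K) (k : ℕ)
    (hc : ∀ s : ℝ, z₀ + s ∈ U →
      Module.rank ℂ (chains (A (z₀ + s)) R k) = Module.rank ℂ (chains (A z₀) R k)) :
    ∀ᶠ z in 𝓝 z₀, Module.rank ℂ (chains (A z) R k) = Module.rank ℂ (chains (A z₀) R k) := by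
  obtain ⟨S, hS, P, J, hPJ⟩ := exists_finite_rank_correction hB hK
  rw [← hBK] at hPJ
  simp_rw [rank_chains_eq] at hc ⊢
  -- The finite-rank correction of `A z₀`, repeated on every diagonal block, also corrects the block
  -- operator.
  refine eventually_rank_ker_eq (N := Fin k → S) (P := diag P k) (J := diag J k) hU
    ((differentiableOn_diag hA k).sub_const _) hz₀ ?_ hc
  have : diag (A z₀) k - shift R k + diag J k ∘L diag P k
      = diag (A z₀ + J ∘L P) k - shift R k := by
    ext1 z
    ext1 i
    simp
    abel
  rw [this]
  exact isUnit_diag_sub_shift hPJ R k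

/-- If `T u = l u + A ((H₀ + 1) u)` on the range of `R = (H₀ + 1)⁻¹`, the generalized eigenspaces
of `T` are isomorphic to the spaces of chains of the pencil `(A, R)`. -/
theorem rank_kerPow_eq_rank_chains {d : ℕ} {T : L2 d →ₗ.[ℂ] L2 d} {l : ℂ} {A R : L2 d →L[ℂ] L2 d}
    (hR : Function.Injective R) (hdom : ∀ v, v ∈ T.domain ↔ ∃ w, R w = v)
    (hT : ∀ (u : T.domain) (w : L2 d), R w = u → T u - l • (u : L2 d) = A w) (k : ℕ) :
    Module.rank ℂ (kerPow T l k) = Module.rank ℂ (chains A R k) := by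
  -- A chain corresponds to v = R z₀, with R z_j = (T - l)^j v. As R is injective, v determines the
  -- whole chain.
  let Φ : (ℕ → L2 d) →ₗ[ℂ] L2 d := R.toLinearMap ∘ₗ LinearMap.proj 0
  have hmap : ∀ (k : ℕ) (z : ℕ → L2 d), z ∈ chains A R k → R (z 0) ∈ kerPow T l k := by
    intro k
    induction k with
    | zero =>
      intro z hz
      rw [hz.1 0 le_rfl, map_zero]
      exact Submodule.zero_mem _
    | succ k ih =>
      intro z hz
      rw [mem_kerPow_succ]
      refine ⟨⟨R (z 0), (hdom _).2 ⟨_, rfl⟩⟩, rfl, ?_⟩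
      rw [hT _ (z 0) rfl, hz.2 0]
      exact ih (fun j => z (j + 1)) ⟨fun j hj => hz.1 _ (by omega), fun j => hz.2 (j + 1)⟩
  have hsurj : ∀ (k : ℕ) (v : L2 d), v ∈ kerPow T l k → ∃ z ∈ chains A R k, R (z 0) = v := by
    intro k
    induction k with
    | zero =>
      intro v hv
      have hv0 : v = 0 := hv
      exact ⟨0, Submodule.zero_mem _, by simp [hv0]⟩
    | succ k ih =>
      intro v hv
      obtain ⟨u, rfl, hu⟩ := (mem_kerPow_succ T l k v).1 hv
      obtain ⟨w, hw⟩ := (hdom u).1 u.2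
      obtain ⟨z, hz, hz0⟩ := ih _ hu
      refine ⟨fun j => Nat.casesOn j w z, ⟨fun j hj => ?_, fun j => ?_⟩, hw⟩
      · cases j with
        | zero => omega
        | succ j => exact hz.1 j (by omega)
      · cases j with
        | zero => exact (hT u w hw).symm.trans hz0.symm
        | succ j => exact hz.2 j
  let Ψ : chains A R k →ₗ[ℂ] kerPow T l k := Φ.restrict (hmap k)
  refine (LinearEquiv.rank_eq (LinearEquiv.ofBijective Ψ ⟨?_, ?_⟩)).symm
  · refine (injective_iff_map_eq_zero Ψ).2 fun z hz => ?_
    have h0 : R ((z : ℕ → L2 d) 0) = 0 := congrArg Subtype.val hz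
    have : ∀ j, (z : ℕ → L2 d) j = 0 := by
      intro j
      induction j with
      | zero => exact hR (by rw [h0, map_zero])
      | succ j ih =>
        refine hR ?_
        rw [← z.2.2 j, ih, map_zero, map_zero]
    exact Subtype.ext (funext this)
  · rintro ⟨v, hv⟩
    obtain ⟨z, hz, hz0⟩ := hsurj k v hv
    exact ⟨⟨z, hz⟩, Subtype.ext hz0⟩

theorem isEigenvalue_iff_kerPow_one_ne_bot {d : ℕ} (T : L2 d →ₗ.[ℂ] L2 d) (l : ℂ) :
    IsEigenvalue T l ↔ kerPow T l 1 ≠ ⊥ := by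
  rw [Submodule.ne_bot_iff]
  constructor
  · rintro ⟨u, hu, hTu⟩
    exact ⟨u, (mem_kerPow_succ T l 0 u).2 ⟨u, rfl, by rw [hTu, sub_self]; exact zero_mem _⟩, hu⟩
  · rintro ⟨v, hv, hv0⟩
    obtain ⟨u, rfl, hu⟩ := (mem_kerPow_succ T l 0 v).1 hv
    exact ⟨u, hv0, sub_eq_zero.1 hu⟩
-- Fourier multipliers and the free resolvent
open scoped FourierTransform

/-- Multiplication of `L²` functions by a bounded function. -/
def boundedMul {d : ℕ} (g : Lp ℂ ∞ (volume : Measure (Space d))) : L2 d →L[ℂ] L2 d :=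
  LinearMap.mkContinuous
    { toFun := fun u => g • u
      map_add' := fun u v => Lp.add_smul g u v
      map_smul' := fun c u => (Lp.smul_comm c g u).symm } ‖g‖
    (fun u => Lp.norm_smul_le g u)

/-- The Fourier multiplier with a bounded symbol, as an operator on `L²`. -/
def fourierMul {d : ℕ} (g : Space d → ℂ) (hg : MemLp g ∞ volume) : L2 d →L[ℂ] L2 d :=
  ((Lp.fourierTransformₗᵢ (Space d) ℂ).symm : L2 d →L[ℂ] L2 d) ∘L boundedMul (hg.toLp g) ∘L
    ((Lp.fourierTransformₗᵢ (Space d) ℂ : L2 d ≃ₗᵢ[ℂ] L2 d) : L2 d →L[ℂ] L2 d)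

theorem fourierMul_apply {d : ℕ} (g : Space d → ℂ) (hg : MemLp g ∞ volume) (u : L2 d) :
    fourierMul g hg u = 𝓕⁻ ((hg.toLp g • (𝓕 u : L2 d) : L2 d)) := rfl

theorem fourier_fourierMul_ae {d : ℕ} (g : Space d → ℂ) (hg : MemLp g ∞ volume) (u : L2 d) :
    (𝓕 (fourierMul g hg u) : L2 d) =ᵐ[volume] fun x => g x * (𝓕 u : L2 d) x := by
  rw [fourierMul_apply, FourierTransform.fourier_fourierInv_eq]
  filter_upwards [Lp.coeFn_lpSMul (r := 2) (hg.toLp g) (𝓕 u : L2 d), hg.coeFn_toLp] with x h1 h2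
  rw [h1, Pi.smul_apply', h2, smul_eq_mul]

theorem eq_of_fourier_ae {d : ℕ} {u v : L2 d}
    (h : (𝓕 u : L2 d) =ᵐ[volume] (𝓕 v : L2 d)) : u = v :=
  (Lp.fourierTransformₗᵢ (Space d) ℂ).injective (Lp.ext h)

theorem fourierMul_fourierMul_of_mul_eq_one {d : ℕ} {g h : Space d → ℂ} (hg : MemLp g ∞ volume)
    (hh : MemLp h ∞ volume) (hgh : ∀ x, g x * h x = 1) :
    fourierMul g hg * fourierMul h hh = 1 := by
  ext1 u
  refine eq_of_fourier_ae ?_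
  filter_upwards [fourier_fourierMul_ae g hg (fourierMul h hh u), fourier_fourierMul_ae h hh u]
    with x h1 h2
  rw [mul_apply_eq_comp, h1, h2, ← mul_assoc, hgh, one_mul]
  rfl

/-- Bridge between L² multipliers, which need a bounded symbol, and multipliers of tempered
distributions, which need temperate growth; Δ is only available as the latter. -/
theorem coe_fourierMul {d : ℕ} {g : Space d → ℂ} (hg : MemLp g ∞ volume)
    (hg' : g.HasTemperateGrowth) (u : L2 d) :
    ((fourierMul g hg u : L2 d) : 𝓢'(Space d, ℂ)) =
      TemperedDistribution.fourierMultiplierCLM ℂ g (u : 𝓢'(Space d, ℂ)) := by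
  rw [TemperedDistribution.fourierMultiplierCLM_apply, Lp.fourier_toTemperedDistribution_eq,
    ← Lp.toTemperedDistribution_smul_eq (p := ∞) (r := 2) hg' hg,
    Lp.fourierInv_toTemperedDistribution_eq]
  rfl

/-- The symbol of `H₀ + 1`. -/
def freeSymbol {d : ℕ} (x : Space d) : ℝ := 1 + ‖(2 * Real.pi) • x‖ ^ 2

theorem one_le_freeSymbol {d : ℕ} (x : Space d) : 1 ≤ freeSymbol x := by
  rw [freeSymbol]
  have := sq_nonneg ‖(2 * Real.pi) • x‖
  linarith

theorem freeSymbol_pos {d : ℕ} (x : Space d) : 0 < freeSymbol x :=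
  one_pos.trans_le (one_le_freeSymbol x)

/-- The symbol of `(H₀ + 1)⁻¹`. -/
def resolventSymbol {d : ℕ} (x : Space d) : ℂ := (((freeSymbol x) ^ (-1 : ℝ) : ℝ) : ℂ)

theorem resolventSymbol_eq {d : ℕ} (x : Space d) : resolventSymbol x = ((freeSymbol x)⁻¹ : ℝ) := by
  rw [resolventSymbol, Real.rpow_neg_one]

theorem continuous_freeSymbol {d : ℕ} : Continuous (freeSymbol (d := d)) := by
  unfold freeSymbol
  fun_prop

theorem hasTemperateGrowth_freeSymbol {d : ℕ} :
    (fun x : Space d => (freeSymbol x : ℂ)).HasTemperateGrowth := by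
  have h : (fun x : Space d => (freeSymbol x : ℂ)) =
      fun x => (((1 + (2 * Real.pi) ^ 2 * ‖x‖ ^ 2 : ℝ)) : ℂ) := by
    ext x
    rw [freeSymbol, norm_smul, mul_pow, Real.norm_eq_abs, sq_abs]
  rw [h]
  fun_prop

/-- The real power in `resolventSymbol` makes it a rescaled Bessel weight, whose growth is known. -/
theorem hasTemperateGrowth_resolventSymbol {d : ℕ} :
    (resolventSymbol (d := d)).HasTemperateGrowth := by
  have h1 := Function.hasTemperateGrowth_one_add_norm_sq_rpow (Space d) (-1)
  have h2 : (fun x : Space d => (2 * Real.pi) • x).HasTemperateGrowth :=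
    ((2 * Real.pi) • ContinuousLinearMap.id ℝ (Space d)).hasTemperateGrowth
  exact Function.Complex.hasTemperateGrowth_ofReal.comp (h1.comp h2)

theorem memLp_top_of_continuous {d : ℕ} {g : Space d → ℂ} (hg : Continuous g) (C : ℝ)
    (hC : ∀ x, ‖g x‖ ≤ C) : MemLp g ∞ (volume : Measure (Space d)) :=
  memLp_top_of_bound hg.aestronglyMeasurable C (Eventually.of_forall hC)

theorem memLp_resolventSymbol {d : ℕ} :
    MemLp (resolventSymbol (d := d)) ∞ (volume : Measure (Space d)) := by
  refine memLp_top_of_continuous hasTemperateGrowth_resolventSymbol.1.continuous 1 fun x => ?_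
  rw [resolventSymbol_eq, Complex.norm_real, Real.norm_eq_abs,
    abs_of_pos (inv_pos.2 (freeSymbol_pos x))]
  exact inv_le_one_of_one_le₀ (one_le_freeSymbol x)

/-- The bounded operator `(H₀ + 1)⁻¹`. -/
def freeResolvent (d : ℕ) : L2 d →L[ℂ] L2 d := fourierMul resolventSymbol memLp_resolventSymbol

theorem coe_freeResolvent {d : ℕ} (w : L2 d) :
    ((freeResolvent d w : L2 d) : 𝓢'(Space d, ℂ)) =
      TemperedDistribution.fourierMultiplierCLM ℂ resolventSymbol (w : 𝓢'(Space d, ℂ)) :=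
  coe_fourierMul _ hasTemperateGrowth_resolventSymbol w

/-- The factor 2π comes from the Fourier kernel e^{-2πi⟨x,ξ⟩}, for which -Δ has symbol |2πξ|². -/
theorem neg_laplacian_add_self {d : ℕ} (u : 𝓢'(Space d, ℂ)) :
    -Δ u + u = TemperedDistribution.fourierMultiplierCLM ℂ (fun x => (freeSymbol x : ℂ)) u := by
  have h : (fun x : Space d => (freeSymbol x : ℂ)) =
      (fun _ => (1 : ℂ)) + (((2 * Real.pi) ^ 2 : ℝ) : ℂ) • fun x => Complex.ofReal (‖x‖ ^ 2) := by
    ext x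
    rw [freeSymbol, norm_smul, mul_pow, Real.norm_eq_abs, sq_abs]
    simp
  have ht : (fun x : Space d => Complex.ofReal (‖x‖ ^ 2)).HasTemperateGrowth := by fun_prop
  rw [h, TemperedDistribution.laplacian_eq_fourierMultiplierCLM,
    TemperedDistribution.fourierMultiplierCLM_apply (_ + _),
    TemperedDistribution.smulLeftCLM_add (by fun_prop) (by fun_prop),
    TemperedDistribution.smulLeftCLM_smul ht, add_apply, smul_apply,
    TemperedDistribution.smulLeftCLM_const, FourierTransform.fourierInv_add,
    FourierTransform.fourierInv_smul, FourierTransform.fourierInv_smul,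
    ← TemperedDistribution.fourierMultiplierCLM_apply, one_smul,
    FourierTransform.fourierInv_fourier_eq, add_comm, neg_smul, neg_neg, Complex.coe_smul]

theorem mul_resolventSymbol {d : ℕ} :
    (resolventSymbol * fun x : Space d => (freeSymbol x : ℂ)) = fun _ => 1 := by
  ext x
  rw [Pi.mul_apply, resolventSymbol_eq, ← Complex.ofReal_mul,
    inv_mul_cancel₀ (freeSymbol_pos x).ne', Complex.ofReal_one]

theorem neg_laplacian_freeResolvent {d : ℕ} (w : L2 d) :
    -Δ ((freeResolvent d w : L2 d) : 𝓢'(Space d, ℂ)) + ((freeResolvent d w : L2 d) : 𝓢'(Space d, ℂ))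
      = (w : 𝓢'(Space d, ℂ)) := by
  rw [neg_laplacian_add_self, coe_freeResolvent,
    TemperedDistribution.fourierMultiplierCLM_fourierMultiplierCLM_apply
      hasTemperateGrowth_resolventSymbol hasTemperateGrowth_freeSymbol, mul_resolventSymbol]
  simp

theorem freeResolvent_eq_of_neg_laplacian {d : ℕ} {u w : L2 d}
    (h : -Δ (u : 𝓢'(Space d, ℂ)) + (u : 𝓢'(Space d, ℂ)) = (w : 𝓢'(Space d, ℂ))) :
    freeResolvent d w = u := by
  apply toTemperedDistribution_inj
  rw [coe_freeResolvent, ← h, neg_laplacian_add_self,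
    TemperedDistribution.fourierMultiplierCLM_fourierMultiplierCLM_apply
      hasTemperateGrowth_freeSymbol hasTemperateGrowth_resolventSymbol, mul_comm,
    mul_resolventSymbol]
  simp

/-- The H² weight times the resolvent symbol is (1 + |x|²)/(1 + |2πx|²), which is at most 1. -/
theorem freeResolvent_mem_sobolevH2 {d : ℕ} (w : L2 d) : freeResolvent d w ∈ sobolevH2 d := by
  have ht : (fun x : Space d => (((1 + ‖x‖ ^ 2) ^ ((2 : ℝ) / 2) : ℝ) : ℂ)).HasTemperateGrowth := by
    fun_prop
  have ht2 := hasTemperateGrowth_resolventSymbol.mul ht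
  have hb : MemLp (resolventSymbol * fun x : Space d => (((1 + ‖x‖ ^ 2) ^ ((2 : ℝ) / 2) : ℝ) : ℂ)) ∞
      volume := by
    refine memLp_top_of_continuous ht2.1.continuous 1 fun x => ?_
    rw [Pi.mul_apply, resolventSymbol_eq, ← Complex.ofReal_mul, div_self two_ne_zero, Real.rpow_one,
      Complex.norm_real, Real.norm_eq_abs, abs_of_pos
        (mul_pos (inv_pos.2 (freeSymbol_pos x)) (by positivity)), inv_mul_le_one₀ (freeSymbol_pos x),
      freeSymbol, norm_smul, mul_pow, Real.norm_eq_abs, sq_abs]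
    have h1 : (1 : ℝ) ≤ (2 * Real.pi) ^ 2 := by nlinarith [Real.pi_gt_three]
    nlinarith [sq_nonneg ‖x‖]
  refine ⟨fourierMul _ hb w, ?_⟩
  rw [coe_fourierMul hb ht2, coe_freeResolvent, TemperedDistribution.besselPotential,
    TemperedDistribution.fourierMultiplierCLM_fourierMultiplierCLM_apply
      hasTemperateGrowth_resolventSymbol ht]

theorem freeHamiltonian_freeResolvent {d : ℕ} (w : L2 d) :
    freeHamiltonian d ⟨freeResolvent d w, freeResolvent_mem_sobolevH2 w⟩ + freeResolvent d w = w := by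
  apply toTemperedDistribution_inj
  rw [← Lp.toTemperedDistributionCLM_apply, map_add, Lp.toTemperedDistributionCLM_apply,
    Lp.toTemperedDistributionCLM_apply, freeHamiltonian_apply]
  exact neg_laplacian_freeResolvent w

theorem freeResolvent_freeHamiltonian {d : ℕ} (u : (freeHamiltonian d).domain) :
    freeResolvent d (freeHamiltonian d u + (u : L2 d)) = u := by
  apply freeResolvent_eq_of_neg_laplacian
  rw [← freeHamiltonian_apply]
  exact (map_add (Lp.toTemperedDistributionCLM ℂ (volume : Measure (Space d)) 2) _ _).symm

theorem injective_freeResolvent (d : ℕ) : Function.Injective (freeResolvent d) := by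
  refine (injective_iff_map_eq_zero (freeResolvent d)).2 fun w hw => ?_
  have h : (⟨freeResolvent d w, freeResolvent_mem_sobolevH2 w⟩ : (freeHamiltonian d).domain) = 0 :=
    Subtype.ext hw
  rw [← freeHamiltonian_freeResolvent w, h, hw, LinearPMap.map_zero, add_zero]

theorem mem_domain_iff_exists_freeResolvent {d : ℕ} (v : L2 d) :
    v ∈ (freeHamiltonian d).domain ↔ ∃ w, freeResolvent d w = v :=
  ⟨fun hv => ⟨_, freeResolvent_freeHamiltonian ⟨v, hv⟩⟩, by
    rintro ⟨w, rfl⟩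
    exact freeResolvent_mem_sobolevH2 w⟩

/-- An `L²` function whose distributional Laplacian is in `L²` is the image under `(H₀ + 1)⁻¹` of
the expected function. -/
theorem freeResolvent_eq_of_coe_eq {d : ℕ} {u f : L2 d}
    (h : (f : 𝓢'(Space d, ℂ)) = -Δ (u : 𝓢'(Space d, ℂ))) : freeResolvent d (f + u) = u := by
  apply freeResolvent_eq_of_neg_laplacian
  rw [← h]
  exact (map_add (Lp.toTemperedDistributionCLM ℂ (volume : Measure (Space d)) 2) _ _).symm

/-- `c H₀ - l`, precomposed with `(H₀ + 1)⁻¹`, is invertible when `l ∉ c [0, ∞)`. -/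
theorem isUnit_smul_sub_smul_freeResolvent {d : ℕ} {c l : ℂ} (hc : c ≠ 0)
    (hl : ∀ r : ℝ, 0 ≤ r → c * r ≠ l) :
    IsUnit (c • (1 - freeResolvent d) - l • freeResolvent d) := by
  -- The symbol of the operator in the variable t = 1/`freeSymbol`. The value t = 0 stands for
  -- infinite momentum, where it is c ≠ 0; a zero at t > 0 would give l = c(1 - t)/t. Compactness of
  -- [0, 1] then bounds the inverse symbol.
  let a : ℝ → ℂ := fun t => c * (1 - t) - l * t
  have ha : ∀ t ∈ Set.Icc (0 : ℝ) 1, a t ≠ 0 := by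
    rintro t ⟨h0, h1⟩ hat
    rcases h0.eq_or_lt with rfl | h0
    · exact hc (by simpa [a] using hat)
    · refine hl ((1 - t) / t) (div_nonneg (by linarith) h0.le) ?_
      have ht : (t : ℂ) ≠ 0 := by exact_mod_cast h0.ne'
      push_cast
      rw [mul_div_assoc', div_eq_iff ht]
      exact sub_eq_zero.1 hat
  have hac : Continuous a := by fun_prop
  obtain ⟨C, hC⟩ := isCompact_Icc.exists_bound_of_continuousOn (s := Set.Icc (0 : ℝ) 1)
    (f := a) hac.continuousOn
  obtain ⟨C', hC'⟩ := isCompact_Icc.exists_bound_of_continuousOn (s := Set.Icc (0 : ℝ) 1)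
    (f := fun t => (a t)⁻¹) (hac.continuousOn.inv₀ ha)
  have hm : ∀ x : Space d, (freeSymbol x)⁻¹ ∈ Set.Icc (0 : ℝ) 1 := fun x =>
    ⟨(inv_pos.2 (freeSymbol_pos x)).le, inv_le_one_of_one_le₀ (one_le_freeSymbol x)⟩
  have hmc : Continuous (fun x : Space d => (freeSymbol x)⁻¹) :=
    continuous_freeSymbol.inv₀ fun x => (freeSymbol_pos x).ne'
  have h1 : MemLp (fun x : Space d => a (freeSymbol x)⁻¹) ∞ volume :=
    memLp_top_of_continuous (hac.comp hmc) C fun x => hC _ (hm x)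
  have h2 : MemLp (fun x : Space d => (a (freeSymbol x)⁻¹)⁻¹) ∞ volume :=
    memLp_top_of_continuous ((hac.comp hmc).inv₀ fun x => ha _ (hm x)) C' fun x => hC' _ (hm x)
  have key : c • (1 - freeResolvent d) - l • freeResolvent d = fourierMul _ h1 := by
    ext1 u
    refine eq_of_fourier_ae ?_
    have he : (𝓕 ((c • (1 - freeResolvent d) - l • freeResolvent d) u) : L2 d) =
        c • ((𝓕 u : L2 d) - (𝓕 (freeResolvent d u) : L2 d)) - l • (𝓕 (freeResolvent d u) : L2 d) := by
      change Lp.fourierTransformₗᵢ (Space d) ℂ (c • (u - freeResolvent d u) - l • freeResolvent d u)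
        = _
      rw [map_sub, map_smul, map_smul, map_sub]
      rfl
    rw [he]
    filter_upwards [fourier_fourierMul_ae _ h1 u, fourier_fourierMul_ae _ memLp_resolventSymbol u,
      Lp.coeFn_sub (c • ((𝓕 u : L2 d) - (𝓕 (freeResolvent d u) : L2 d)))
        (l • (𝓕 (freeResolvent d u) : L2 d)),
      Lp.coeFn_smul c ((𝓕 u : L2 d) - (𝓕 (freeResolvent d u) : L2 d)),
      Lp.coeFn_smul l (𝓕 (freeResolvent d u) : L2 d),
      Lp.coeFn_sub (𝓕 u : L2 d) (𝓕 (freeResolvent d u) : L2 d)] with x e1 e2 e3 e4 e5 e6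
    have e2' : (𝓕 (freeResolvent d u) : L2 d) x = resolventSymbol x * (𝓕 u : L2 d) x := e2
    rw [e1, e3, Pi.sub_apply, e4, e5, Pi.smul_apply, Pi.smul_apply, e6, Pi.sub_apply, e2',
      resolventSymbol_eq, smul_eq_mul, smul_eq_mul]
    ring
  rw [key]
  refine ⟨⟨fourierMul _ h1, fourierMul _ h2, fourierMul_fourierMul_of_mul_eq_one h1 h2 fun x => ?_,
    fourierMul_fourierMul_of_mul_eq_one h2 h1 fun x => ?_⟩, rfl⟩
  · exact mul_inv_cancel₀ (ha _ (hm x))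
  · exact inv_mul_cancel₀ (ha _ (hm x))

/-! ### Continuation from horizontal lines -/

/-- Two analytic families, one in `L²` and one in `L^p`, that satisfy `f z = g z * u` for all `z` on
a horizontal line satisfy it on the whole domain. -/
theorem ae_eq_mul_of_forall_add_real {d : ℕ} {p : ℝ≥0∞} [hp : Fact (1 ≤ p)] {U : Set ℂ}
    (hU : IsOpen U) (hUc : IsPreconnected U) {f : ℂ → L2 d}
    {g : ℂ → Lp ℂ p (volume : Measure (Space d))} (hf : DifferentiableOn ℂ f U)
    (hg : DifferentiableOn ℂ g U) (u : L2 d) {z₀ : ℂ} (hz₀ : z₀ ∈ U)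
    (h : ∀ s : ℝ, z₀ + s ∈ U → f (z₀ + s) =ᵐ[volume] fun x => g (z₀ + s) x * u x) :
    ∀ z ∈ U, f z =ᵐ[volume] fun x => g z x * u x := by
  intro z hz
  -- The identity is tested weakly, after which scalar analytic continuation applies. Truncating to
  -- sets of finite measure on which |u| ≤ n puts u into every L^q, in particular into the dual
  -- exponent of p.
  have : ENNReal.HolderConjugate p (1 - p⁻¹)⁻¹ := ENNReal.HolderConjugate.inv_one_sub_inv' hp.out
  have hq : Fact (1 ≤ (1 - p⁻¹)⁻¹) := by simp [fact_iff]
  have hum : Measurable (u : Space d → ℂ) := (Lp.stronglyMeasurable u).measurable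
  let E : ℕ → Set (Space d) := fun n => {x | ‖u x‖ ≤ n}
  have hE : ∀ n, MeasurableSet (E n) := fun n => measurableSet_le hum.norm measurable_const
  have hφ : ∀ (q : ℝ≥0∞) (n : ℕ) (s : Set (Space d)), MeasurableSet s → volume s < ∞ →
      MemLp ((s ∩ E n).indicator (u : Space d → ℂ)) q volume := by
    intro q n s hs hμs
    rw [memLp_indicator_iff_restrict (hs.inter (hE n))]
    have : IsFiniteMeasure (volume.restrict (s ∩ E n)) :=
      ⟨by rw [Measure.restrict_apply_univ]; exact (measure_mono Set.inter_subset_left).trans_lt hμs⟩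
    refine MemLp.of_bound hum.aestronglyMeasurable n ?_
    exact (ae_restrict_mem (hs.inter (hE n))).mono fun x hx => hx.2
  have hψ : ∀ (n : ℕ) (s : Set (Space d)), MeasurableSet s → volume s < ∞ →
      MemLp ((s ∩ E n).indicator (fun _ => (1 : ℂ))) 2 volume := fun n s hs hμs =>
    memLp_indicator_const 2 (hs.inter (hE n)) 1
      (Or.inr ((measure_mono Set.inter_subset_left).trans_lt hμs).ne)
  have hmul1 : ∀ (n : ℕ) (s : Set (Space d)) (z : ℂ) (x : Space d),
      (s ∩ E n).indicator (f z : Space d → ℂ) x =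
        f z x * (s ∩ E n).indicator (fun _ => (1 : ℂ)) x := fun n s z x => by
    by_cases hx : x ∈ s ∩ E n <;> simp [hx]
  have hmul2 : ∀ (n : ℕ) (s : Set (Space d)) (z : ℂ) (x : Space d),
      (s ∩ E n).indicator (fun x => g z x * u x) x =
        g z x * (s ∩ E n).indicator (u : Space d → ℂ) x := fun n s z x => by
    by_cases hx : x ∈ s ∩ E n <;> simp [hx]
  have key : ∀ (n : ℕ) (s : Set (Space d)), MeasurableSet s → volume s < ∞ →
      ∫ x, (s ∩ E n).indicator (f z : Space d → ℂ) x =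
        ∫ x, (s ∩ E n).indicator (fun x => g z x * u x) x := by
    intro n s hs hμs
    let B := ContinuousLinearMap.mul ℂ ℂ
    let Λ₁ : L2 d →L[ℂ] ℂ := (B.lpPairing volume 2 2).flip ((hψ n s hs hμs).toLp _)
    let Λ₂ : Lp ℂ p (volume : Measure (Space d)) →L[ℂ] ℂ :=
      (B.lpPairing volume p (1 - p⁻¹)⁻¹).flip ((hφ _ n s hs hμs).toLp _)
    have hΛ₁ : ∀ z, Λ₁ (f z) = ∫ x, (s ∩ E n).indicator (f z : Space d → ℂ) x := by
      intro z
      refine (B.lpPairing_eq_integral (f z) _).trans (integral_congr_ae ?_)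
      filter_upwards [(hψ n s hs hμs).coeFn_toLp] with x hx
      rw [hx, hmul1]
      rfl
    have hΛ₂ : ∀ z, Λ₂ (g z) = ∫ x, (s ∩ E n).indicator (fun x => g z x * u x) x := by
      intro z
      refine (B.lpPairing_eq_integral (g z) _).trans (integral_congr_ae ?_)
      filter_upwards [(hφ (1 - p⁻¹)⁻¹ n s hs hμs).coeFn_toLp] with x hx
      rw [hx, hmul2]
      rfl
    have hd : DifferentiableOn ℂ (fun z => Λ₁ (f z) - Λ₂ (g z)) U :=
      (Λ₁.differentiable.comp_differentiableOn hf).sub (Λ₂.differentiable.comp_differentiableOn hg)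
    have h0 := eq_zero_of_forall_add_real_eq_zero hU hUc hd hz₀ (fun s' hs' => ?_) z hz
    · rw [← hΛ₁, ← hΛ₂]
      exact sub_eq_zero.1 h0
    · rw [sub_eq_zero, hΛ₁, hΛ₂]
      refine integral_congr_ae ?_
      filter_upwards [h s' hs'] with x hx
      by_cases hxs : x ∈ s ∩ E n <;> simp [hxs, hx]
  have hn : ∀ n : ℕ, (E n).indicator (f z : Space d → ℂ) =ᵐ[volume]
      (E n).indicator (fun x => g z x * u x) := by
    intro n
    refine ae_eq_of_forall_setIntegral_eq_of_sigmaFinite ?_ ?_ ?_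
    · intro s hs hμs
      rw [← integrable_indicator_iff hs, Set.indicator_indicator]
      refine Integrable.congr ((Lp.memLp (f z)).integrable_mul (hψ n s hs hμs)) ?_
      exact Eventually.of_forall fun x => (hmul1 n s z x).symm
    · intro s hs hμs
      rw [← integrable_indicator_iff hs, Set.indicator_indicator]
      refine Integrable.congr ((Lp.memLp (g z)).integrable_mul (hφ (1 - p⁻¹)⁻¹ n s hs hμs)) ?_
      exact Eventually.of_forall fun x => (hmul2 n s z x).symm
    · intro s hs hμs
      rw [← integral_indicator hs, ← integral_indicator hs, Set.indicator_indicator,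
        Set.indicator_indicator]
      exact key n s hs hμs
  filter_upwards [ae_all_iff.2 hn] with x hx
  obtain ⟨n, hxn⟩ := exists_nat_ge ‖u x‖
  have hxE : x ∈ E n := hxn
  simpa [hxE] using hx n

/-- An analytic function with values in a closed subspace along a horizontal line takes values in
that subspace on the whole domain. -/
theorem mem_of_forall_add_real_mem {E : Type*} [NormedAddCommGroup E] [NormedSpace ℂ E]
    [CompleteSpace E] {S : Submodule ℂ E} (hS : IsClosed (S : Set E)) {U : Set ℂ} (hU : IsOpen U)
    (hUc : IsPreconnected U) {f : ℂ → E} (hf : DifferentiableOn ℂ f U) {z₀ : ℂ} (hz₀ : z₀ ∈ U)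
    (h : ∀ s : ℝ, z₀ + s ∈ U → f (z₀ + s) ∈ S) : ∀ z ∈ U, f z ∈ S := by
  have := hS
  -- Membership in S is vanishing in the quotient E/S, which is a Banach space since S is closed.
  have hd : DifferentiableOn ℂ (fun z => S.mkQL (f z)) U :=
    S.mkQL.differentiable.comp_differentiableOn hf
  intro z hz
  refine (Submodule.Quotient.mk_eq_zero S).1 ?_
  exact eq_zero_of_forall_add_real_eq_zero hU hUc hd hz₀
    (fun s hs => (Submodule.Quotient.mk_eq_zero S).2 (h s hs)) z hz

/-! ### Real dilations -/

theorem memLp_comp_smul {d : ℕ} {c : ℝ} (hc : c ≠ 0) {f : Space d → ℂ} {p : ℝ≥0∞}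
    (hf : MemLp f p volume) : MemLp (fun x => f (c • x)) p volume := by
  have h : MemLp f p (Measure.map (c • ·) (volume : Measure (Space d))) := by
    rw [Measure.map_addHaar_smul volume hc]
    exact hf.smul_measure ENNReal.ofReal_ne_top
  exact h.comp_of_map (measurable_const_smul c).aemeasurable

theorem comp_smul_ae_eq {d : ℕ} {c : ℝ} (hc : c ≠ 0) {f g : Space d → ℂ} (h : f =ᵐ[volume] g) :
    (fun x => f (c • x)) =ᵐ[volume] fun x => g (c • x) :=
  (Measure.quasiMeasurePreserving_smul volume hc).ae_eq_comp h

/-- Composition with the dilation `x ↦ e^s x`, on `L²`. -/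
def dilation (d : ℕ) (s : ℝ) : L2 d →L[ℂ] L2 d :=
  LinearMap.mkContinuous
    { toFun := fun u => (memLp_comp_smul (Real.exp_pos s).ne' (Lp.memLp u)).toLp _
      map_add' := fun u v =>
        (MemLp.toLp_congr _ ((memLp_comp_smul (Real.exp_pos s).ne' (Lp.memLp u)).add
          (memLp_comp_smul (Real.exp_pos s).ne' (Lp.memLp v)))
          (comp_smul_ae_eq (Real.exp_pos s).ne' (Lp.coeFn_add u v))).trans (MemLp.toLp_add _ _)
      map_smul' := fun c u =>
        (MemLp.toLp_congr _ ((memLp_comp_smul (Real.exp_pos s).ne' (Lp.memLp u)).const_smul c)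
          (comp_smul_ae_eq (Real.exp_pos s).ne' (Lp.coeFn_smul c u))).trans
          (MemLp.toLp_const_smul c _) }
    -- The square root of the Jacobian, e^{-sd/2}: the dilation is not normalized to be unitary,
    -- since only its invertibility matters.
    ((ENNReal.ofReal |(Real.exp s ^ Module.finrank ℝ (Space d))⁻¹|) ^
      (1 / (2 : ℝ≥0∞)).toReal).toReal
    (fun u => by
      change ‖(memLp_comp_smul (Real.exp_pos s).ne' (Lp.memLp u)).toLp _‖ ≤ _
      rw [Lp.norm_toLp, Lp.norm_def, ← ENNReal.toReal_mul]
      have h1 : eLpNorm (fun x => u (Real.exp s • x)) 2 volume =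
          eLpNorm u 2 (Measure.map (Real.exp s • ·) (volume : Measure (Space d))) :=
        (eLpNorm_map_measure (Lp.stronglyMeasurable u).aestronglyMeasurable
          (measurable_const_smul (Real.exp s)).aemeasurable).symm
      rw [h1, Measure.map_addHaar_smul volume (Real.exp_pos s).ne',
        eLpNorm_smul_measure_of_ne_top ENNReal.ofNat_ne_top, smul_eq_mul])

theorem dilation_ae {d : ℕ} (s : ℝ) (u : L2 d) :
    dilation d s u =ᵐ[volume] fun x => u (Real.exp s • x) :=
  MemLp.coeFn_toLp (memLp_comp_smul (Real.exp_pos s).ne' (Lp.memLp u))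

theorem dilation_dilation_of_add_eq_zero {d : ℕ} {s t : ℝ} (h : s + t = 0) (u : L2 d) :
    dilation d s (dilation d t u) = u := by
  refine Lp.ext ?_
  filter_upwards [dilation_ae s (dilation d t u),
    comp_smul_ae_eq (Real.exp_pos s).ne' (dilation_ae t u)] with x h1 h2
  rw [h1, h2, smul_smul, ← Real.exp_add, add_comm, h, Real.exp_zero, one_smul]

/-- Dilation of Schwartz functions. -/
def schwartzDilation (d : ℕ) (s : ℝ) : 𝓢(Space d, ℂ) →L[ℂ] 𝓢(Space d, ℂ) :=
  SchwartzMap.compCLMOfContinuousLinearEquiv ℂ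
    (ContinuousLinearEquiv.smulLeft (Units.mk0 (Real.exp s) (Real.exp_pos s).ne'))

theorem schwartzDilation_apply {d : ℕ} (s : ℝ) (φ : 𝓢(Space d, ℂ)) (x : Space d) :
    schwartzDilation d s φ x = φ (Real.exp s • x) := rfl

theorem laplacian_schwartzDilation {d : ℕ} (s : ℝ) (φ : 𝓢(Space d, ℂ)) :
    Δ (schwartzDilation d s φ) = Real.exp (2 * s) • schwartzDilation d s (Δ φ) := by
  have h : ∀ (m : Space d) (ψ : 𝓢(Space d, ℂ)), LineDeriv.lineDerivOp m (schwartzDilation d s ψ) =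
      Real.exp s • schwartzDilation d s (LineDeriv.lineDerivOp m ψ) := by
    intro m ψ
    rw [schwartzDilation, SchwartzMap.lineDerivOp_compCLMOfContinuousLinearEquiv]
    have : (ContinuousLinearEquiv.smulLeft (Units.mk0 (Real.exp s) (Real.exp_pos s).ne') :
      Space d ≃L[ℝ] Space d) m = Real.exp s • m := rfl
    rw [this, LineDeriv.lineDerivOp_left_smul]
    rfl
  rw [SchwartzMap.laplacian_eq_sum (stdOrthonormalBasis ℝ (Space d)),
    SchwartzMap.laplacian_eq_sum (stdOrthonormalBasis ℝ (Space d)), map_sum, Finset.smul_sum]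
  refine Finset.sum_congr rfl fun i _ => ?_
  rw [h, LineDeriv.lineDerivOp_smul, h, smul_smul, ← Real.exp_add, two_mul]

theorem coe_dilation_apply {d : ℕ} (s : ℝ) (u : L2 d) (φ : 𝓢(Space d, ℂ)) :
    ((dilation d s u : L2 d) : 𝓢'(Space d, ℂ)) φ =
      |(Real.exp s ^ Module.finrank ℝ (Space d))⁻¹| •
        (u : 𝓢'(Space d, ℂ)) (schwartzDilation d (-s) φ) := by
  rw [Lp.toTemperedDistribution_apply, Lp.toTemperedDistribution_apply,
    ← Measure.integral_comp_smul]
  refine integral_congr_ae ?_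
  filter_upwards [dilation_ae s u] with x hx
  rw [hx, schwartzDilation_apply, smul_smul, ← Real.exp_add, neg_add_cancel, Real.exp_zero,
    one_smul]

/-- The dilation rule for the Laplacian of `L²` functions. -/
theorem coe_dilation_eq_neg_laplacian {d : ℕ} (s : ℝ) {u f : L2 d}
    (h : (f : 𝓢'(Space d, ℂ)) = -Δ (u : 𝓢'(Space d, ℂ))) :
    ((((Real.exp (2 * s) : ℝ) : ℂ) • dilation d s f : L2 d) : 𝓢'(Space d, ℂ)) =
      -Δ ((dilation d s u : L2 d) : 𝓢'(Space d, ℂ)) := by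
  rw [← Lp.toTemperedDistributionCLM_apply, map_smul, Lp.toTemperedDistributionCLM_apply]
  ext φ
  have h1 : ∀ ψ : 𝓢(Space d, ℂ), (f : 𝓢'(Space d, ℂ)) ψ = -(u : 𝓢'(Space d, ℂ)) (Δ ψ) := by
    intro ψ
    rw [h, neg_apply, TemperedDistribution.laplacian_apply_apply]
  have h2 : schwartzDilation d (-s) (Δ φ) =
      Real.exp (2 * s) • Δ (schwartzDilation d (-s) φ) := by
    rw [laplacian_schwartzDilation, smul_smul, ← Real.exp_add]
    simp
  rw [smul_apply, neg_apply, TemperedDistribution.laplacian_apply_apply, coe_dilation_apply,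
    coe_dilation_apply, h1, h2, ← Complex.coe_smul (Real.exp (2 * s)), map_smul, Complex.coe_smul,
    Complex.coe_smul, smul_neg, smul_neg, smul_comm]

/-- The bounded operator `(e^{-2s} H₀ + 1) (H₀ + 1)⁻¹`. -/
def dilatedSymbol (d : ℕ) (s : ℝ) : L2 d →L[ℂ] L2 d :=
  ((Real.exp (-2 * s) : ℝ) : ℂ) • (1 - freeResolvent d) + freeResolvent d

/-- Scaling gives (H₀ + 1) D = D (e^{-2s} H₀ + 1) on H² for D = `dilation d (-s)`. -/
theorem freeResolvent_dilation {d : ℕ} (s : ℝ) (w : L2 d) :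
    freeResolvent d (dilation d (-s) (dilatedSymbol d s w)) =
      dilation d (-s) (freeResolvent d w) := by
  have h1 : ((w - freeResolvent d w : L2 d) : 𝓢'(Space d, ℂ)) =
      -Δ ((freeResolvent d w : L2 d) : 𝓢'(Space d, ℂ)) := by
    have h2 := freeHamiltonian_apply ⟨freeResolvent d w, freeResolvent_mem_sobolevH2 w⟩
    rw [← eq_sub_iff_add_eq.2 (freeHamiltonian_freeResolvent w), h2]
  have h3 := freeResolvent_eq_of_coe_eq (coe_dilation_eq_neg_laplacian (-s) h1)
  refine (congrArg (freeResolvent d) ?_).trans h3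
  rw [dilatedSymbol, ← map_smul, ← map_add]
  congr 1
  simp

/-! ### The pencil of the dilated Hamiltonian -/

/-- A domain-free form, from which it is plain that W determines K and that the relation can be
continued analytically. -/
theorem isMulResolvent_iff {d : ℕ} {W : Space d → ℂ} {K : L2 d →L[ℂ] L2 d} :
    IsMulResolvent W K ↔
      ∀ w, K w =ᵐ[volume] fun x => W x * (freeResolvent d w) x := by
  constructor
  · intro h w
    obtain ⟨hu, hKu⟩ := h ⟨freeResolvent d w, freeResolvent_mem_sobolevH2 w⟩
    rw [freeHamiltonian_freeResolvent] at hKu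
    rw [hKu]
    exact MemLp.coeFn_toLp hu
  · intro h u
    have hw := h (freeHamiltonian d u + (u : L2 d))
    rw [freeResolvent_freeHamiltonian] at hw
    have hu : MemLp (fun x => W x * (u : L2 d) x) 2 volume :=
      (memLp_congr_ae hw).1 (Lp.memLp _)
    refine ⟨hu, Lp.ext (hw.trans ?_)⟩
    exact (MemLp.coeFn_toLp hu).symm

/-- The pencil `(c H₀ - l + W) (H₀ + 1)⁻¹`, where `K = W (H₀ + 1)⁻¹`. -/
def pencil {d : ℕ} (c l : ℂ) (K : L2 d →L[ℂ] L2 d) : L2 d →L[ℂ] L2 d :=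
  c • (1 - freeResolvent d) - l • freeResolvent d + K

/-- Since H₀ R = 1 - R, the pencil is H(θ) - l composed with R; the domain of H(θ) is all of H², the
range of R. -/
theorem rank_kerPow_dilatedHamiltonian {d : ℕ} {W : Space d → ℂ} {K : L2 d →L[ℂ] L2 d}
    (h : IsMulResolvent W K) (θ l : ℂ) (k : ℕ) :
    Module.rank ℂ (kerPow (dilatedHamiltonian θ W) l k) =
      Module.rank ℂ (chains (pencil (Complex.exp (-2 * θ)) l K) (freeResolvent d) k) := by
  refine rank_kerPow_eq_rank_chains (injective_freeResolvent d) (fun v => ?_) (fun u w huw => ?_) k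
  · rw [← mem_domain_iff_exists_freeResolvent]
    constructor
    · exact fun hv => hv.1
    · intro hv
      obtain ⟨hv', -⟩ := h ⟨v, hv⟩
      exact ⟨hv, hv'⟩
  · have h1 : (⟨(u : L2 d), u.2.1⟩ : (freeHamiltonian d).domain) =
        ⟨freeResolvent d w, freeResolvent_mem_sobolevH2 w⟩ := Subtype.ext huw.symm
    have h2 : freeHamiltonian d ⟨(u : L2 d), u.2.1⟩ = w - freeResolvent d w := by
      rw [h1]
      exact eq_sub_of_add_eq (freeHamiltonian_freeResolvent w)
    have h3 : mulOp W ⟨(u : L2 d), u.2.2⟩ = K w := by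
      refine Lp.ext ((MemLp.coeFn_toLp (u.2.2 : MemLp _ 2 volume)).trans ?_)
      refine EventuallyEq.trans ?_ (isMulResolvent_iff.1 h w).symm
      rw [huw]
    have h4 : dilatedHamiltonian θ W u = Complex.exp (-2 * θ) •
        freeHamiltonian d ⟨(u : L2 d), u.2.1⟩ + mulOp W ⟨(u : L2 d), u.2.2⟩ := rfl
    rw [h4, h2, h3, ← huw, pencil]
    simp
    abel

theorem hamiltonian_eq_dilatedHamiltonian_zero {d : ℕ} (V : Space d → ℂ) :
    hamiltonian V = dilatedHamiltonian 0 V := by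
  rw [hamiltonian, dilatedHamiltonian, mul_zero, Complex.exp_zero, one_smul]

theorem isOpen_strip (α : ℝ) : IsOpen (strip α) :=
  isOpen_lt (by fun_prop) continuous_const

theorem convex_strip (α : ℝ) : Convex ℝ (strip α) := by
  have : strip α = Complex.imLm ⁻¹' Metric.ball 0 α := by
    ext z
    simp [strip]
  rw [this]
  exact (convex_ball 0 α).linear_preimage _

theorem add_real_mem_strip {α : ℝ} {z : ℂ} (hz : z ∈ strip α) (s : ℝ) : z + s ∈ strip α := by
  simpa [strip] using hz

/-! ### The analytic family on the strip -/

section Family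

variable {d : ℕ} {α : ℝ} {V : Space d → ℂ} {F : ℂ → L2 d →L[ℂ] L2 d}

/-- Covariance of the continuation of `V_θ (H₀ + 1)⁻¹` under real dilations. -/
theorem dilation_mul_resolvent_family (hα : 0 < α) (hF : DifferentiableOn ℂ F (strip α))
    (hFV : ∀ t : ℝ, IsMulResolvent (fun x => V (Real.exp t • x)) (F (t : ℂ))) (s : ℝ) :
    ∀ z ∈ strip α,
      F z * (dilation d (-s) * dilatedSymbol d s) = dilation d (-s) * F (z + s) := by
  have hd : DifferentiableOn ℂ (fun z => F z * (dilation d (-s) * dilatedSymbol d s) -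
      dilation d (-s) * F (z + s)) (strip α) := by
    refine (hF.mul (differentiableOn_const _)).sub ((differentiableOn_const _).mul ?_)
    exact hF.comp (differentiableOn_id.add_const _) fun z hz => add_real_mem_strip hz s
  have h0 : (0 : ℂ) ∈ strip α := by simpa [strip] using hα
  intro z hz
  -- With s fixed, continuation is in z; for real z = t the identity is the substitution V(e^t x)
  -- u(e^{-s} x) = (V_{t+s} u)(e^{-s} x).
  refine sub_eq_zero.1 (eq_zero_of_forall_add_real_eq_zero (isOpen_strip α)
    (convex_strip α).isPreconnected hd h0 (fun t _ => ?_) z hz)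
  rw [sub_eq_zero, zero_add]
  ext1 w
  refine Lp.ext ?_
  rw [mul_apply_eq_comp, mul_apply_eq_comp, mul_apply_eq_comp, ← Complex.ofReal_add]
  filter_upwards [isMulResolvent_iff.1 (hFV t) (dilation d (-s) (dilatedSymbol d s w)),
    dilation_ae (-s) (F ((t + s : ℝ) : ℂ) w), dilation_ae (-s) (freeResolvent d w),
    comp_smul_ae_eq (Real.exp_pos (-s)).ne' (isMulResolvent_iff.1 (hFV (t + s)) w)]
    with x h1 h2 h3 h4
  rw [h1, h2, h4, freeResolvent_dilation, h3, smul_smul, ← Real.exp_add, add_neg_cancel_right]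

/-- On the real line covariance expresses `F s` through the compact `F 0`. The compact operators
form a closed subspace, so compactness continues to the strip. -/
theorem isCompactOperator_resolvent_family (hα : 0 < α) (hF : DifferentiableOn ℂ F (strip α))
    (hFV : ∀ t : ℝ, IsMulResolvent (fun x => V (Real.exp t • x)) (F (t : ℂ)))
    (hc : IsCompactOperator (F 0)) : ∀ z ∈ strip α, IsCompactOperator (F z) := by
  have h0 : (0 : ℂ) ∈ strip α := by simpa [strip] using hα
  refine mem_of_forall_add_real_mem (S := compactOperator (RingHom.id ℂ) (L2 d) (L2 d))
    isClosed_setOfPred_isCompactOperator (isOpen_strip α) (convex_strip α).isPreconnected hF h0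
    fun s _ => ?_
  have h1 : F (0 + s) = dilation d s * (F 0 * (dilation d (-s) * dilatedSymbol d s)) := by
    rw [dilation_mul_resolvent_family hα hF hFV s 0 h0]
    ext1 w
    exact (dilation_dilation_of_add_eq_zero (add_neg_cancel s) _).symm
  rw [h1]
  exact IsCompactOperator.clm_comp (hc.comp_clm (dilation d (-s) * dilatedSymbol d s))
    (dilation d s)

/-- The intertwiner on chains is T = (H₀ + 1) D (H₀ + 1)⁻¹ with D = `dilation d (-s)`: it satisfies
R T = D R and A(z) T = D A(z + s). -/
theorem rank_chains_add_real_le (hα : 0 < α) (hF : DifferentiableOn ℂ F (strip α))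
    (hFV : ∀ t : ℝ, IsMulResolvent (fun x => V (Real.exp t • x)) (F (t : ℂ))) (l : ℂ) (k : ℕ)
    {z : ℂ} (hz : z ∈ strip α) (s : ℝ) :
    Module.rank ℂ (chains (pencil (Complex.exp (-2 * (z + s))) l (F (z + s))) (freeResolvent d) k) ≤
      Module.rank ℂ (chains (pencil (Complex.exp (-2 * z)) l (F z)) (freeResolvent d) k) := by
  have hR : freeResolvent d * (dilation d (-s) * dilatedSymbol d s) =
      dilation d (-s) * freeResolvent d := ContinuousLinearMap.ext (freeResolvent_dilation s)
  refine rank_chains_le (dilation d (-s) * dilatedSymbol d s) (dilation d (-s)) ?_ ?_ hR k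
  · have h1 : Function.Injective (dilation d (-s)) := by
      refine Function.LeftInverse.injective (g := dilation d s) fun u => ?_
      exact dilation_dilation_of_add_eq_zero (add_neg_cancel s) u
    refine Function.Injective.of_comp (f := freeResolvent d) ?_
    have h2 : freeResolvent d ∘ (dilation d (-s) * dilatedSymbol d s : L2 d →L[ℂ] L2 d) =
        dilation d (-s) ∘ freeResolvent d := congrArg DFunLike.coe hR
    rw [h2]
    exact h1.comp (injective_freeResolvent d)
  · have he : Complex.exp (-2 * (z + s)) =
        Complex.exp (-2 * z) * ((Real.exp (-2 * s) : ℝ) : ℂ) := by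
      rw [Complex.ofReal_exp, ← Complex.exp_add]
      congr 1
      push_cast
      ring
    have hT : dilation d (-s) * dilatedSymbol d s - dilation d (-s) * freeResolvent d =
        ((Real.exp (-2 * s) : ℝ) : ℂ) • (dilation d (-s) * (1 - freeResolvent d)) := by
      rw [dilatedSymbol, mul_add, add_sub_cancel_right, mul_smul_comm]
    rw [pencil, pencil, add_mul, sub_mul, smul_mul_assoc, smul_mul_assoc, sub_mul, one_mul, hR, hT,
      dilation_mul_resolvent_family hα hF hFV s z hz, he, mul_add,
      mul_sub (dilation d (-s)) (_ • _) (_ • _),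
      mul_smul_comm, mul_smul_comm, smul_smul]

theorem rank_chains_add_real (hα : 0 < α) (hF : DifferentiableOn ℂ F (strip α))
    (hFV : ∀ t : ℝ, IsMulResolvent (fun x => V (Real.exp t • x)) (F (t : ℂ))) (l : ℂ) (k : ℕ)
    {z : ℂ} (hz : z ∈ strip α) (s : ℝ) :
    Module.rank ℂ (chains (pencil (Complex.exp (-2 * (z + s))) l (F (z + s))) (freeResolvent d) k) =
      Module.rank ℂ (chains (pencil (Complex.exp (-2 * z)) l (F z)) (freeResolvent d) k) := by
  refine le_antisymm (rank_chains_add_real_le hα hF hFV l k hz s) ?_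
  have h := rank_chains_add_real_le hα hF hFV l k (add_real_mem_strip hz s) (-s)
  rwa [Complex.ofReal_neg, add_neg_cancel_right] at h

/-- Away from e^{-2z₀}[0, ∞) the free part of the pencil is invertible, and the potential part `F
z₀` is compact. -/
theorem eventually_rank_chains_pencil_eq (hα : 0 < α) (hF : DifferentiableOn ℂ F (strip α))
    (hFV : ∀ t : ℝ, IsMulResolvent (fun x => V (Real.exp t • x)) (F (t : ℂ)))
    (hc : IsCompactOperator (F 0)) (l : ℂ) (k : ℕ) {z₀ : ℂ} (hz₀ : z₀ ∈ strip α)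
    (hl : ∀ r : ℝ, 0 ≤ r → Complex.exp (-2 * z₀) * r ≠ l) :
    ∀ᶠ z in 𝓝 z₀,
      Module.rank ℂ (chains (pencil (Complex.exp (-2 * z)) l (F z)) (freeResolvent d) k) =
        Module.rank ℂ (chains (pencil (Complex.exp (-2 * z₀)) l (F z₀)) (freeResolvent d) k) := by
  refine eventually_rank_chains_eq (A := fun z => pencil (Complex.exp (-2 * z)) l (F z))
    (freeResolvent d) (isOpen_strip α) ?_ hz₀
    (isUnit_smul_sub_smul_freeResolvent (Complex.exp_ne_zero (-2 * z₀)) hl)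
    (isCompactOperator_resolvent_family hα hF hFV hc z₀ hz₀) rfl k
    fun s _ => rank_chains_add_real hα hF hFV l k hz₀ s
  have h1 : DifferentiableOn ℂ (fun z : ℂ => Complex.exp (-2 * z)) (strip α) := by fun_prop
  exact ((h1.smul_const _).sub_const _).add hF

end Family

/-! ### Deformation from 0 to θ -/

/-- The half-line `e^{-2z} [0, ∞)` does not meet the half-plane of `z` when `|Im z| ≤ π/2`. -/
theorem exp_mul_ne_of_im {z l : ℂ} (hz : |z.im| ≤ Real.pi / 2)
    (h : (0 < l.im ∧ 0 ≤ z.im) ∨ (l.im < 0 ∧ z.im ≤ 0)) (r : ℝ) (hr : 0 ≤ r) :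
    Complex.exp (-2 * z) * r ≠ l := by
  intro hl
  have him : l.im = -(Real.exp (-2 * z.re) * Real.sin (2 * z.im) * r) := by
    rw [← hl, Complex.im_mul_ofReal, Complex.exp_im]
    simp
  obtain ⟨h1, h2⟩ := abs_le.1 hz
  rcases h with ⟨hl0, hz0⟩ | ⟨hl0, hz0⟩
  · have : 0 ≤ Real.sin (2 * z.im) := Real.sin_nonneg_of_nonneg_of_le_pi (by linarith) (by linarith)
    have : 0 ≤ Real.exp (-2 * z.re) * Real.sin (2 * z.im) * r := by positivity
    linarith
  · have h3 : Real.sin (2 * z.im) ≤ 0 :=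
      Real.sin_nonpos_of_nonpos_of_neg_pi_le (by linarith) (by linarith)
    have : Real.exp (-2 * z.re) * Real.sin (2 * z.im) * r ≤ 0 :=
      mul_nonpos_of_nonpos_of_nonneg (mul_nonpos_of_nonneg_of_nonpos (Real.exp_pos _).le h3) hr
    linarith

theorem rank_kerPow_eq {d : ℕ} {γ : ℝ} [Fact (1 ≤ γ)] {α : ℝ} (hα : 0 < α) {V : Space d → ℂ}
    {𝒱 : ℂ → Lp ℂ (potExp d γ) (volume : Measure (Space d))} (hV : IsDilationAnalytic α V 𝒱)
    {l θ : ℂ} (hθ : θ ∈ strip α) (hθ' : |θ.im| ≤ Real.pi / 2)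
    (hsign : (0 < l.im ∧ 0 < θ.im) ∨ (l.im < 0 ∧ θ.im < 0)) (k : ℕ) :
    Module.rank ℂ (kerPow (dilatedHamiltonian θ (𝒱 θ)) l k) =
      Module.rank ℂ (kerPow (hamiltonian V) l k) := by
  obtain ⟨K, hK, hKV⟩ := hV.relCompact
  obtain ⟨F, hF, hFV⟩ := hV.resolvent_analytic
  have h0 : (0 : ℂ) ∈ strip α := by simpa [strip] using hα
  have hF0 : IsMulResolvent V (F 0) := by simpa using hFV 0
  have hFK : F 0 = K := by
    ext1 w
    exact Lp.ext ((isMulResolvent_iff.1 hF0 w).trans (isMulResolvent_iff.1 hKV w).symm)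
  have hc : IsCompactOperator (F 0) := hFK ▸ hK
  -- The two continuations of V_θ, as an L^p function and as an operator, are compatible:
  -- multiplication by `𝒱 θ` after R is `F θ`, by continuation from real θ.
  have hFθ : IsMulResolvent (𝒱 θ) (F θ) := by
    refine isMulResolvent_iff.2 fun w => ?_
    refine ae_eq_mul_of_forall_add_real (isOpen_strip α) (convex_strip α).isPreconnected
      (f := fun z => F z w) (hF.clm_apply (differentiableOn_const w)) hV.analytic
      (freeResolvent d w) h0 (fun s _ => ?_) θ hθ
    rw [zero_add]
    filter_upwards [isMulResolvent_iff.1 (hFV s) w, hV.eq_dilation s] with x h1 h2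
    rw [h1, h2]
  rw [hamiltonian_eq_dilatedHamiltonian_zero, rank_kerPow_dilatedHamiltonian hF0,
    rank_kerPow_dilatedHamiltonian hFθ]
  -- A locally constant quantity on the connected segment takes equal values at its ends.
  refine (convex_segment (𝕜 := ℝ) (0 : ℂ) θ).isPreconnected.induction₂'
    (fun z w => Module.rank ℂ
      (chains (pencil (Complex.exp (-2 * z)) l (F z)) (freeResolvent d) k) =
      Module.rank ℂ (chains (pencil (Complex.exp (-2 * w)) l (F w)) (freeResolvent d) k))
    (fun z hz => ?_) (fun _ _ _ _ _ _ h1 h2 => h1.trans h2) (right_mem_segment ℝ 0 θ)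
    (left_mem_segment ℝ 0 θ)
  have hzs : z ∈ strip α := (convex_strip α).segment_subset h0 hθ hz
  have hz' : |z.im| ≤ Real.pi / 2 ∧ ((0 < l.im ∧ 0 ≤ z.im) ∨ (l.im < 0 ∧ z.im ≤ 0)) := by
    rw [segment_eq_image] at hz
    obtain ⟨t, ⟨ht0, ht1⟩, rfl⟩ := hz
    have him : ((1 - t) • (0 : ℂ) + t • θ).im = t * θ.im := by simp
    rw [him]
    refine ⟨?_, ?_⟩
    · rw [abs_mul, abs_of_nonneg ht0]
      exact (mul_le_of_le_one_left (abs_nonneg _) ht1).trans hθ'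
    · rcases hsign with ⟨h1, h2⟩ | ⟨h1, h2⟩
      · exact Or.inl ⟨h1, mul_nonneg ht0 h2.le⟩
      · exact Or.inr ⟨h1, mul_nonpos_of_nonneg_of_nonpos ht0 h2.le⟩
  have hev := eventually_rank_chains_pencil_eq hα hF hFV hc l k hzs (exp_mul_ne_of_im hz'.1 hz'.2)
  filter_upwards [nhdsWithin_le_nhds hev] with w hw
  exact ⟨hw.symm, hw⟩

end DilationAnalytic

end

theorem lemma3p2 (d : ℕ) (hd : 1 ≤ d) (γ : ℝ) [Fact (1 ≤ γ)] (α : ℝ) (hα : Real.pi / 4 < α)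
    (V : DilationAnalytic.Space d → ℂ)
    (𝒱 : ℂ → MeasureTheory.Lp ℂ (DilationAnalytic.potExp d γ)
      (MeasureTheory.volume : MeasureTheory.Measure (DilationAnalytic.Space d)))
    (hV : DilationAnalytic.IsDilationAnalytic α V 𝒱)
    (l : ℂ) (hl : DilationAnalytic.IsEigenvalue (DilationAnalytic.hamiltonian V) l)
    (θ : ℂ) (hθ : θ ∈ DilationAnalytic.strip α) (hθ' : |θ.im| ≤ Real.pi / 2)
    (hsign : (0 < l.im ∧ 0 < θ.im) ∨ (l.im < 0 ∧ θ.im < 0)) :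
    DilationAnalytic.IsEigenvalue (DilationAnalytic.dilatedHamiltonian θ (𝒱 θ)) l ∧
      DilationAnalytic.algMult (DilationAnalytic.dilatedHamiltonian θ (𝒱 θ)) l =
        DilationAnalytic.algMult (DilationAnalytic.hamiltonian V) l := by
  have h := DilationAnalytic.rank_kerPow_eq ((div_pos Real.pi_pos four_pos).trans hα) hV hθ hθ'
    hsign
  refine ⟨?_, ?_⟩
  -- Being an eigenvalue is the case k = 1: a kernel of nonzero dimension.
  · rw [DilationAnalytic.isEigenvalue_iff_kerPow_one_ne_bot, ne_eq, ← Submodule.rank_eq_zero] at hl ⊢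
    rwa [h 1]
  · simp only [DilationAnalytic.algMult, h]
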